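/- Let all graphs be finite and simple. A square of period $p\ge 1$ is a word of the form $uu$ with $|u|=p$. For a graph $G$ and an integer $k\ge 0$, let $\pi_k(G)$ be the minimum number of colors in a (not necessarily proper) vertex coloring of $G$ such that, for every path of $G$ (with pairwise distinct vertices), the sequence of colors along the path is not a square of period at least $k$. For a class $C$ of graphs, let $\pi_k(C)=\sup_{G\in C}\pi_k(G)$. Let $\mathrm{planar}$ be the class of planar graphs and let $tw_3$ be the class of graphs of treewidth at most $3$. Then for every integer $k\ge 0$, $$\pi_k(\mathrm{planar}\cap tw_3)\ge 11,$$ that is, there is a planar graph of treewidth at most $3$ such that every coloring of it with at most $10$ colors has a path whose color sequence is a square of period at least $k$. In particular, there is no $k$ such that $\pi_k(\mathrm{planar})=4$, so Grytczuk's conjecture that $\pi_k(\mathrm{planar})=4$ for some $k$ is false. -/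

import Mathlib

namespace ThuePlanar

/-- The word `w` is a square of period `p`: `w = uu` for a nonempty word `u` of length `p`. -/
def IsSquareOfPeriod {α : Type*} (p : ℕ) (w : List α) : Prop :=
  0 < p ∧ ∃ u : List α, u.length = p ∧ w = u ++ u

/-- The vertex coloring `c` of `G` avoids squares of period at least `k`: the sequence of colors
along a path of `G` (a walk without repeated vertices) is never a square of period at least `k`.
The coloring is not required to be proper. -/
def AvoidsSquares {V α : Type*} (G : SimpleGraph V) (k : ℕ) (c : V → α) : Prop :=
  ∀ (u v : V) (P : G.Walk u v), P.IsPath →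
    ∀ p : ℕ, k ≤ p → ¬ IsSquareOfPeriod p (P.support.map c)

/-- `π_k(G)`: the minimum number of colors in a coloring of `G` that avoids squares of period
at least `k`. -/
noncomputable def thueNumber {V : Type*} (k : ℕ) (G : SimpleGraph V) : ℕ∞ :=
  ⨅ (m : ℕ) (_ : ∃ c : V → Fin m, AvoidsSquares G k c), (m : ℕ∞)

/-- `π_k(C)`: the supremum of `π_k(G)` over the finite graphs `G` in the class `C`. -/
noncomputable def classThueNumber (k : ℕ) (C : ∀ V : Type, SimpleGraph V → Prop) : ℕ∞ :=
  ⨆ (V : Type) (_ : Finite V) (G : SimpleGraph V) (_ : C V G), thueNumber k G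

/-- A drawing of `G` in the Euclidean plane without crossings: vertices are distinct points, the
edge `uv` is a simple arc from `u` to `v`, an arc contains no vertices besides its two ends, and
two distinct arcs meet only in common ends. The values of `arc` off the edge set are irrelevant. -/
structure PlaneDrawing {V : Type*} (G : SimpleGraph V) where
  pos : V → EuclideanSpace ℝ (Fin 2)
  pos_injective : Function.Injective pos
  arc : Sym2 V → Set (EuclideanSpace ℝ (Fin 2))
  arc_simple : ∀ u v : V, G.Adj u v →
    ∃ γ : Path (pos u) (pos v), Function.Injective γ ∧ Set.range γ = arc s(u, v)
  mem_of_pos_mem : ∀ e ∈ G.edgeSet, ∀ w : V, pos w ∈ arc e → w ∈ e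
  arc_inter : ∀ e ∈ G.edgeSet, ∀ f ∈ G.edgeSet, e ≠ f →
    ∀ x ∈ arc e ∩ arc f, ∃ w : V, w ∈ e ∧ w ∈ f ∧ x = pos w

/-- `G` is planar: it can be drawn in the plane without crossings. -/
def IsPlanar {V : Type*} (G : SimpleGraph V) : Prop :=
  Nonempty (PlaneDrawing G)

/-- A tree decomposition of `G`, with a finite tree on the index type `I`. -/
structure TreeDecomposition {V : Type*} (G : SimpleGraph V) (I : Type) where
  finite_index : Finite I
  tree : SimpleGraph I
  isTree : tree.IsTree
  bag : I → Finset V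
  vertex_cover : ∀ v : V, ∃ i, v ∈ bag i
  edge_cover : ∀ u v : V, G.Adj u v → ∃ i, u ∈ bag i ∧ v ∈ bag i
  connected : ∀ v : V, (tree.induce {i | v ∈ bag i}).Connected

/-- `G` has treewidth at most `t`: some tree decomposition of `G` has all bags of size at most
`t + 1`. -/
def TreewidthAtMost {V : Type*} (t : ℕ) (G : SimpleGraph V) : Prop :=
  ∃ (I : Type) (D : TreeDecomposition G I), ∀ i, (D.bag i).card ≤ t + 1

end ThuePlanar

/-!
# Planar graphs of treewidth three that need eleven colors

The graphs are truncations of the infinite Apollonian network, in which a vertex is stacked into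
each triangular face and joined to its three corners, and so on in the three new faces. They are
planar (`isPlanar_apollonian`, by a straight-line drawing) and have treewidth at most three
(`treewidthAtMost_three`). By compactness (`exists_truncation_not_avoidsSquares`) it suffices that
the infinite network has no coloring `c` with ten colors without squares of period greater than `k`
(`not_noLongSquare`).

A vertex `p` serves as a hub: if two disjoint long paths `Q`, `Q'` in its neighborhood have the same
color word and `z` is adjacent to the end of `Q'`, then `Q p Q' z` is a path, and a square if `z`
has the color of `p`. Repetitions `Q`, `Q'` are available by the pigeonhole principle, because two
corners of a face have infinitely many common neighbors inside it, which form a path, their *fan*.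
So two corners of a face have distinct colors (`NoLongSquare.corner_ne`), and in a suitable subface
the color of `p` is not repeated at the later neighbors of its neighbors
(`NoLongSquare.exists_clean`); `p` is then called clean.

Three consecutive vertices of a walk that descends through clean vertices have distinct colors.
As it must not be possible to descend along a word of period three within the neighborhood of a
vertex, the number of colors in this neighborhood is greater by at least three than the minimal
number `e` of colors on a fan (`NoLongSquare.add_three_le_linkColors`). Since the coloring is proper
and fans are not `2`-periodic, `e ≥ 3`, so all palettes have at least six colors.

With ten colors this permits two walks that descend simultaneously with the same color word, one of
them within the neighborhood of a vertex `y` (`NoLongSquare.exists_synchronous_walks`). The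
consequence is an exchange principle (`NoLongSquare.notMem_linkColors`): if `x`, `y` are adjacent,
it cannot be that `x` has further neighbors with the color of `y` and `y` has clean ones with the
color of `x`, as there would be a square `(y' x W) (y z W')`.

Finally consider the fan of two clean hubs. Its vertices have palettes without their own color and
the colors of the two hubs, so within a set of seven colors, and by the exchange principle
one of two consecutive vertices misses the color of the other. As the palettes have size at least
six, each vertex misses at most one of the seven colors, which forces three consecutive colors far out in the fan
to be distinct (`eventually_eq_or_ne`). As the fan is not `3`-periodic, it has four colors. Hence
`e ≥ 4`, and the palettes have all seven possible colors, a contradiction.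
-/

namespace ThuePlanar

/-! ### The infinite Apollonian network -/

/-- Vertices of the infinite Apollonian network: three outer corners, and one stacked vertex for
each face. A face is a word over `Fin 3`, read from right to left: the face `i :: w` arises from
the face `w` by replacing its `i`-th corner by the vertex stacked in `w`. Thus `u ++ w` runs over
the faces inside `w`. -/
abbrev Vtx : Type := Fin 3 ⊕ List (Fin 3)

/-- The `j`-th corner of the face `w`. -/
def corner : List (Fin 3) → Fin 3 → Vtx
  | [], j => Sum.inl j
  | i :: w, j => if j = i then Sum.inr w else corner w j

/-- The number of the stacking step in which a vertex appears, `0` for the outer corners. -/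
def age : Vtx → ℕ := Sum.elim (fun _ => 0) (fun w => w.length + 1)

@[simp] lemma age_inr (w : List (Fin 3)) : age (Sum.inr w) = w.length + 1 := rfl

@[simp] lemma corner_cons_self (i : Fin 3) (w : List (Fin 3)) :
    corner (i :: w) i = Sum.inr w := by
  simp [corner]

lemma corner_cons_of_ne {i j : Fin 3} (h : j ≠ i) (w : List (Fin 3)) :
    corner (i :: w) j = corner w j := by
  simp [corner, h]

lemma corner_append {i : Fin 3} {u : List (Fin 3)} (h : i ∉ u) (w : List (Fin 3)) :
    corner (u ++ w) i = corner w i := by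
  induction u with
  | nil => rfl
  | cons j u ih =>
    rw [List.mem_cons, not_or] at h
    rw [List.cons_append, corner_cons_of_ne h.1, ih h.2]

lemma age_corner_le (w : List (Fin 3)) (i : Fin 3) : age (corner w i) ≤ w.length := by
  induction w with
  | nil => simp [age, corner]
  | cons j w ih =>
    by_cases h : i = j
    · subst h; simp
    · rw [corner_cons_of_ne h]; exact ih.trans (by simp)

/-- The infinite Apollonian network, without the edges between the outer corners: each stacked
vertex is joined to the three corners of its face. -/
def apollonian : SimpleGraph Vtx where
  Adj a b := (∃ w i, a = Sum.inr w ∧ b = corner w i) ∨ (∃ w i, b = Sum.inr w ∧ a = corner w i)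
  symm := ⟨fun _ _ h => h.symm⟩
  loopless := ⟨fun a h => by
    have key : ∀ w i, a = Sum.inr w → a = corner w i → False := by
      intro w i h₁ h₂
      have := age_corner_le w i
      rw [← h₂, h₁, age_inr] at this
      omega
    rcases h with ⟨w, i, h₁, h₂⟩ | ⟨w, i, h₁, h₂⟩ <;> exact key w i h₁ h₂⟩

lemma adj_corner (w : List (Fin 3)) (i : Fin 3) :
    apollonian.Adj (Sum.inr w) (corner w i) :=
  Or.inl ⟨w, i, rfl, rfl⟩

lemma adj_corner_of_notMem {i : Fin 3} {u : List (Fin 3)} (h : i ∉ u) (w : List (Fin 3)) :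
    apollonian.Adj (Sum.inr (u ++ w)) (corner w i) := by
  rw [← corner_append h w]
  exact adj_corner _ _

/-- The vertices stacked inside the face `w`. -/
def Below (w : List (Fin 3)) : Set Vtx := {v | ∃ u, v = Sum.inr (u ++ w)}

lemma inr_mem_below (u w : List (Fin 3)) : (Sum.inr (u ++ w) : Vtx) ∈ Below w := ⟨u, rfl⟩

lemma inr_mem_below_self (w : List (Fin 3)) : (Sum.inr w : Vtx) ∈ Below w := ⟨[], rfl⟩

lemma below_append (u w : List (Fin 3)) : Below (u ++ w) ⊆ Below w := by
  rintro v ⟨t, rfl⟩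
  exact ⟨t ++ u, by simp⟩

lemma below_cons (i : Fin 3) (w : List (Fin 3)) : Below (i :: w) ⊆ Below w :=
  below_append [i] w

lemma age_of_mem_below {w : List (Fin 3)} {v : Vtx} (h : v ∈ Below w) : w.length < age v := by
  obtain ⟨u, rfl⟩ := h
  rw [age_inr, List.length_append]
  omega

lemma notMem_below_of_age {w : List (Fin 3)} {v : Vtx} (h : age v ≤ w.length) : v ∉ Below w :=
  fun h' => absurd (age_of_mem_below h') (by omega)

lemma corner_notMem_below (w : List (Fin 3)) (i : Fin 3) : corner w i ∉ Below w :=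
  notMem_below_of_age (age_corner_le w i)

lemma below_cons_disjoint {i j : Fin 3} (h : i ≠ j) (w : List (Fin 3)) :
    Disjoint (Below (i :: w)) (Below (j :: w)) := by
  rw [Set.disjoint_left]
  rintro _ ⟨u, rfl⟩ ⟨v, hv⟩
  have h₁ : u ++ i :: w = v ++ j :: w := Sum.inr_injective hv
  have h₂ : (u ++ [i]) ++ w = (v ++ [j]) ++ w := by simpa using h₁
  have h₃ := List.append_cancel_right h₂
  have h₄ := List.append_inj_right' h₃ rfl
  exact h (by simpa using h₄)

lemma corner_injective (w : List (Fin 3)) : Function.Injective (corner w) := by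
  induction w with
  | nil => exact Sum.inl_injective
  | cons l w ih =>
    have key : ∀ i, corner w i ≠ Sum.inr w := fun i h =>
      corner_notMem_below w i (h ▸ inr_mem_below_self w)
    intro i j h
    by_cases hi : i = l <;> by_cases hj : j = l
    · rw [hi, hj]
    · subst hi
      rw [corner_cons_self, corner_cons_of_ne hj] at h
      exact absurd h.symm (key j)
    · subst hj
      rw [corner_cons_self, corner_cons_of_ne hi] at h
      exact absurd h (key i)
    · rw [corner_cons_of_ne hi, corner_cons_of_ne hj] at h
      exact ih h

/-- A letter different from two given ones. -/
def third (i j : Fin 3) : Fin 3 := if i = j then i + 1 else -(i + j)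

lemma third_ne_left : ∀ i j : Fin 3, third i j ≠ i := by decide

lemma third_ne_right : ∀ i j : Fin 3, third i j ≠ j := by decide

/-! ### Fans -/

/-- The `a`-th vertex of the fan in `w` around the two corners with index different from `l`. -/
def fanVtx (l : Fin 3) (w : List (Fin 3)) (a : ℕ) : Vtx := Sum.inr (List.replicate a l ++ w)

/-- The first `n` vertices of the fan in `w` around the two corners with index different from
`l`. -/
def fan (l : Fin 3) : List (Fin 3) → ℕ → List Vtx
  | _, 0 => []
  | w, n + 1 => Sum.inr w :: fan l (l :: w) n

lemma fanVtx_succ (l : Fin 3) (w : List (Fin 3)) (a : ℕ) :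
    fanVtx l (l :: w) a = fanVtx l w (a + 1) := by
  simp only [fanVtx, List.replicate_succ', List.append_assoc, List.singleton_append]

lemma fanVtx_add (l : Fin 3) (w : List (Fin 3)) (a b : ℕ) :
    fanVtx l (List.replicate b l ++ w) a = fanVtx l w (b + a) := by
  simp only [fanVtx, ← List.append_assoc, List.replicate_append_replicate]
  rw [add_comm]

lemma fan_eq (l : Fin 3) (w : List (Fin 3)) (n : ℕ) :
    fan l w n = (List.range n).map (fanVtx l w) := by
  induction n generalizing w with
  | zero => rfl
  | succ n ih =>
    rw [fan, ih, List.range_succ_eq_map, List.map_cons, List.map_map]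
    congr 1
    apply List.map_congr_left
    intro a _
    exact fanVtx_succ l w a

@[simp] lemma length_fan (l : Fin 3) (w : List (Fin 3)) (n : ℕ) : (fan l w n).length = n := by
  simp [fan_eq]

lemma mem_fan {l : Fin 3} {w : List (Fin 3)} {n : ℕ} {v : Vtx} :
    v ∈ fan l w n ↔ ∃ a < n, fanVtx l w a = v := by
  simp [fan_eq]

lemma fan_add (l : Fin 3) (w : List (Fin 3)) (m n : ℕ) :
    fan l w (m + n) = fan l w m ++ fan l (List.replicate m l ++ w) n := by
  simp only [fan_eq, List.range_add, List.map_append, List.map_map]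
  congr 1
  apply List.map_congr_left
  intro a _
  exact (fanVtx_add l w a m).symm

lemma mem_below_of_mem_fan {l : Fin 3} {w : List (Fin 3)} {n : ℕ} {v : Vtx}
    (h : v ∈ fan l w n) : v ∈ Below w := by
  obtain ⟨a, -, rfl⟩ := mem_fan.1 h
  exact inr_mem_below _ _

lemma age_le_of_mem_fan {l : Fin 3} {w : List (Fin 3)} {n : ℕ} {v : Vtx}
    (h : v ∈ fan l w n) : age v ≤ w.length + n := by
  obtain ⟨a, ha, rfl⟩ := mem_fan.1 h
  simp [fanVtx]; omega

lemma fanVtx_adj {l i : Fin 3} (h : i ≠ l) (w : List (Fin 3)) (a : ℕ) :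
    apollonian.Adj (fanVtx l w a) (corner w i) :=
  adj_corner_of_notMem (by simp [List.mem_replicate, h]) w

lemma adj_of_mem_fan {l i : Fin 3} (h : i ≠ l) {w : List (Fin 3)} {n : ℕ} {v : Vtx}
    (hv : v ∈ fan l w n) : apollonian.Adj v (corner w i) := by
  obtain ⟨a, -, rfl⟩ := mem_fan.1 hv
  exact fanVtx_adj h w a

lemma fanVtx_adj_succ (l : Fin 3) (w : List (Fin 3)) (a : ℕ) :
    apollonian.Adj (fanVtx l w a) (fanVtx l w (a + 1)) := by
  have := adj_corner (List.replicate (a + 1) l ++ w) l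
  rw [List.replicate_succ, List.cons_append, corner_cons_self] at this
  exact this.symm

lemma isChain_fan (l : Fin 3) (w : List (Fin 3)) (n : ℕ) :
    (fan l w n).IsChain apollonian.Adj := by
  induction n generalizing w with
  | zero => exact List.IsChain.nil
  | succ n ih =>
    rw [fan, List.isChain_cons]
    refine ⟨fun y hy => ?_, ih _⟩
    cases n with
    | zero => simp [fan] at hy
    | succ n =>
      simp only [fan, List.head?_cons, Option.mem_def, Option.some.injEq] at hy
      subst hy
      exact fanVtx_adj_succ l w 0

lemma nodup_fan (l : Fin 3) (w : List (Fin 3)) (n : ℕ) : (fan l w n).Nodup := by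
  induction n generalizing w with
  | zero => exact List.nodup_nil
  | succ n ih =>
    rw [fan, List.nodup_cons]
    refine ⟨fun h => ?_, ih _⟩
    have := age_of_mem_below (mem_below_of_mem_fan h)
    simp at this

lemma isChain_append_of_forall {α : Type*} {R : α → α → Prop} {s t : List α}
    (hs : s.IsChain R) (ht : t.IsChain R) (h : ∀ x ∈ s, ∀ y ∈ t.head?, R x y) :
    (s ++ t).IsChain R :=
  List.isChain_append.2 ⟨hs, ht, fun x hx => h x (List.mem_of_mem_getLast? hx)⟩

/-- Configurations that occur arbitrarily far out and are described by words of bounded length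
over a finite alphabet: some word is repeated by two configurations far apart from each other. -/
lemma exists_repeated_word {X α : Type*} [Finite α] {L : ℕ} (word : X → List α)
    (bound : X → ℕ) (Q : ℕ → X → Prop) (h : ∀ n, ∃ x, Q n x ∧ (word x).length = L) :
    ∃ m n x y, Q m x ∧ Q n y ∧ bound x ≤ n ∧ word x = word y := by
  choose f hf hL using h
  have : Finite {l : List α // l.length = L} := (List.finite_length_eq α L).to_subtype
  obtain ⟨u, hu⟩ := Finite.exists_infinite_fiber
    (fun n => (⟨word (f n), hL n⟩ : {l : List α // l.length = L}))
  have hinf := Set.infinite_coe_iff.1 hu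
  obtain ⟨m, hm⟩ := hinf.nonempty
  obtain ⟨n, hn, hlt⟩ := hinf.exists_gt (bound (f m))
  refine ⟨m, n, f m, f n, hf m, hf n, hlt.le, ?_⟩
  rw [Set.mem_preimage, Set.mem_singleton_iff] at hm hn
  exact congrArg Subtype.val (hm.trans hn.symm)

/-! ### Colorings of the network without long squares -/

lemma isChain_cons_of_forall {α : Type*} {R : α → α → Prop} {a : α} {s : List α}
    (hs : s.IsChain R) (h : ∀ x ∈ s, R a x) : (a :: s).IsChain R :=
  List.isChain_cons.2 ⟨fun y hy => h y (List.mem_of_mem_head? hy), hs⟩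

/-- No path of the network, written as the concatenation of two halves, has the same sequence of
more than `k` colors along both halves. -/
def NoLongSquare (k : ℕ) (c : Vtx → Fin 10) : Prop :=
  ∀ A B : List Vtx, (A ++ B).IsChain apollonian.Adj → (A ++ B).Nodup → k < A.length →
    A.map c ≠ B.map c

variable {k : ℕ} {c : Vtx → Fin 10}

/-- Distinct corners `p`, `q` of a face have distinct colors: otherwise two segments `S`, `S'` of
their fan with the same color word give the square `p S q S'`. -/
lemma NoLongSquare.corner_ne (hc : NoLongSquare k c) (w : List (Fin 3)) {i j : Fin 3}
    (hij : i ≠ j) : c (corner w i) ≠ c (corner w j) := by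
  intro heq
  obtain ⟨l, hil, hjl⟩ : ∃ l, i ≠ l ∧ j ≠ l :=
    ⟨third i j, (third_ne_left i j).symm, (third_ne_right i j).symm⟩
  obtain ⟨m, n, _, _, rfl, rfl, hmn, hw⟩ := exists_repeated_word (L := k + 1)
    (fun a => (fan l (List.replicate a l ++ w) (k + 1)).map c) (fun a => a + (k + 1))
    (fun n a => n = a) (fun n => ⟨n, rfl, by simp⟩)
  have hco : ∀ a, ∀ i, i ≠ l → corner (List.replicate a l ++ w) i = corner w i := fun a i h =>
    corner_append (by simp [List.mem_replicate, h]) w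
  have hadj : ∀ a, ∀ i, i ≠ l → ∀ v ∈ fan l (List.replicate a l ++ w) (k + 1),
      apollonian.Adj v (corner w i) := fun a i h v hv => by
    rw [← hco a i h]; exact adj_of_mem_fan h hv
  have hpB : ∀ a, ∀ i, corner w i ∉ fan l (List.replicate a l ++ w) (k + 1) := fun a i h =>
    corner_notMem_below w i (below_append _ _ (mem_below_of_mem_fan h))
  refine hc (corner w i :: fan l (List.replicate m l ++ w) (k + 1))
    (corner w j :: fan l (List.replicate n l ++ w) (k + 1)) ?_ ?_ (by simp) (by simp [heq, hw])
  · have h₁ := isChain_cons_of_forall (isChain_fan l (List.replicate n l ++ w) (k + 1))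
      (fun v hv => (hadj n j hjl v hv).symm)
    have h₂ := isChain_append_of_forall (isChain_fan l (List.replicate m l ++ w) (k + 1)) h₁
      (fun v hv y hy => by
        simp only [List.head?_cons, Option.mem_def, Option.some.injEq] at hy
        subst hy; exact hadj m j hjl v hv)
    rw [List.cons_append, List.isChain_cons]
    refine ⟨fun y hy => ?_, h₂⟩
    simp only [fan, List.cons_append, List.head?_cons, Option.mem_def, Option.some.injEq] at hy
    subst hy
    exact (hadj m i hil _ (by simp [fan])).symm
  · rw [List.cons_append, List.nodup_cons, List.nodup_append, List.nodup_cons]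
    refine ⟨?_, nodup_fan _ _ _, ⟨hpB n j, nodup_fan _ _ _⟩, ?_⟩
    · simp only [List.mem_append, List.mem_cons, not_or]
      exact ⟨hpB m i, fun h => hij (corner_injective w h), hpB n i⟩
    · intro v hv v' hv' hvv
      subst hvv
      rcases List.mem_cons.1 hv' with rfl | hv'
      · exact hpB m j hv
      · have h₁ := age_le_of_mem_fan hv
        have h₂ := age_of_mem_below (mem_below_of_mem_fan hv')
        simp only [List.length_append, List.length_replicate] at h₁ h₂
        omega

/-- A vertex has a color different from that of each corner of a surrounding face that it is
adjacent to. -/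
lemma NoLongSquare.ne_corner (hc : NoLongSquare k c) (w : List (Fin 3)) {i : Fin 3}
    {u : List (Fin 3)} (h : i ∉ u) : c (Sum.inr (u ++ w)) ≠ c (corner w i) := by
  have := hc.corner_ne (third i i :: (u ++ w)) (third_ne_left i i)
  rwa [corner_cons_self, corner_cons_of_ne (third_ne_left i i).symm, corner_append h] at this

/-- The color of the `i`-th corner `p` of `w` is not repeated, inside `w`, at a later neighbor of
a neighbor of `p`. -/
def Clean (c : Vtx → Fin 10) (w : List (Fin 3)) (i : Fin 3) : Prop :=
  ∀ u, i ∉ u → ∀ j v, j ∉ v → c (Sum.inr (v ++ j :: (u ++ w))) ≠ c (corner w i)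

lemma Clean.append {w : List (Fin 3)} {i : Fin 3} (h : Clean c w i) {u : List (Fin 3)}
    (hu : i ∉ u) : Clean c (u ++ w) i := by
  intro u' hu' j v hv
  rw [corner_append hu, ← List.append_assoc]
  exact h (u' ++ u) (by simp [hu, hu']) j v hv

/-- Going down a fan around `p`, one reaches a face in which `p` is clean. Otherwise one finds,
arbitrarily far down, long paths `Q` in the neighborhood of `p` that extend to a vertex `z` with
the color of `p`; two of them, with the same color word, give the square `Q p Q' z`. -/
lemma NoLongSquare.exists_clean (hc : NoLongSquare k c) (w : List (Fin 3)) {i l : Fin 3}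
    (hil : i ≠ l) : ∃ a, Clean c (List.replicate a l ++ w) i := by
  by_contra hcon
  have hbad : ∀ n, ∃ x : List (Fin 3) × Fin 3 × List (Fin 3),
      (∃ u, i ∉ u ∧ x.1 = u ++ w ∧ n ≤ x.1.length) ∧ x.2.1 ∉ x.2.2 ∧
        c (Sum.inr (x.2.2 ++ x.2.1 :: x.1)) = c (corner w i) := by
    intro n
    have h : ¬ Clean c (List.replicate n l ++ w) i := fun h => hcon ⟨n, h⟩
    simp only [Clean, not_forall, not_not] at h
    obtain ⟨u, hu, j, v, hv, hz⟩ := h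
    have hi : i ∉ List.replicate n l := by simp [List.mem_replicate, hil]
    rw [corner_append hi] at hz
    exact ⟨⟨u ++ (List.replicate n l ++ w), j, v⟩,
      ⟨u ++ List.replicate n l, by simp [hu, hi], by simp, by simp; omega⟩, hv, hz⟩
  -- In the face `F`, stacking `y`, the path to `y` runs in the fan of `p` and `y` in the subface
  -- that is neither the one losing `p` nor the one containing `z`.
  let fl : List (Fin 3) × Fin 3 × List (Fin 3) → Fin 3 := fun x => third i (third i x.2.1)
  let path : List (Fin 3) × Fin 3 × List (Fin 3) → List Vtx :=
    fun x => fan (fl x) (third i x.2.1 :: x.1) k ++ [Sum.inr x.1]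
  obtain ⟨m, n, x, y, ⟨⟨u, hu, hxu, -⟩, -, -⟩, ⟨⟨u', hu', hyu, hlen⟩, hyv, hz⟩, hxn, hw⟩ :=
    exists_repeated_word (L := k + 1) (fun x => (path x).map c)
      (fun x => x.1.length + k + 1) _ (fun n => (hbad n).imp fun x hx => ⟨hx, by simp [path]⟩)
  have hpath : ∀ x : List (Fin 3) × Fin 3 × List (Fin 3), ∀ u, i ∉ u → x.1 = u ++ w →
      (path x).IsChain apollonian.Adj ∧ (path x).Nodup ∧
      (∀ v ∈ path x, apollonian.Adj v (corner w i)) ∧ (∀ v ∈ path x, v ∈ Below x.1) ∧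
      (∀ v ∈ path x, age v ≤ x.1.length + k + 1) := by
    intro x u hu hx
    have hne : third i x.2.1 ≠ i := third_ne_left _ _
    have hco : corner (third i x.2.1 :: x.1) i = corner w i := by
      rw [corner_cons_of_ne hne.symm, hx, corner_append hu]
    refine ⟨isChain_append_of_forall (isChain_fan _ _ _) (List.isChain_singleton _) ?_, ?_, ?_,
      ?_, ?_⟩
    · intro v hv y hy
      simp only [List.head?_cons, Option.mem_def, Option.some.injEq] at hy
      subst hy
      have := adj_of_mem_fan (i := third i x.2.1) (third_ne_right _ _).symm hv
      rwa [corner_cons_self] at this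
    · refine List.nodup_append.2 ⟨nodup_fan _ _ _, List.nodup_singleton _, ?_⟩
      intro v hv y hy hvy
      rw [List.mem_singleton] at hy
      subst hvy; subst hy
      have := age_of_mem_below (mem_below_of_mem_fan hv)
      simp at this
    · intro v hv
      rcases List.mem_append.1 hv with hv | hv
      · rw [← hco]
        exact adj_of_mem_fan (third_ne_left _ _).symm hv
      · rw [List.mem_singleton] at hv
        subst hv
        rw [hx]
        exact adj_corner_of_notMem hu w
    · intro v hv
      rcases List.mem_append.1 hv with hv | hv
      · exact below_cons _ _ (mem_below_of_mem_fan hv)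
      · rw [List.mem_singleton] at hv
        subst hv
        exact inr_mem_below_self _
    · intro v hv
      rcases List.mem_append.1 hv with hv | hv
      · have := age_le_of_mem_fan hv
        simp only [List.length_cons] at this
        omega
      · rw [List.mem_singleton] at hv
        subst hv
        simp
  obtain ⟨hx₁, hx₂, hx₃, hx₄, hx₅⟩ := hpath x u hu hxu
  obtain ⟨hy₁, hy₂, hy₃, hy₄, hy₅⟩ := hpath y u' hu' hyu
  have hpx : corner w i ∉ path x := fun h =>
    corner_notMem_below w i (by have := hx₄ _ h; rw [hxu] at this; exact below_append _ _ this)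
  have hpy : corner w i ∉ path y := fun h =>
    corner_notMem_below w i (by have := hy₄ _ h; rw [hyu] at this; exact below_append _ _ this)
  set z : Vtx := Sum.inr (y.2.2 ++ y.2.1 :: y.1) with hzdef
  have hzB : z ∈ Below y.1 := below_cons _ _ (inr_mem_below _ _)
  have hzy : z ∉ path y := by
    intro h
    rcases List.mem_append.1 h with h | h
    · exact Set.disjoint_left.1 (below_cons_disjoint (third_ne_right i y.2.1) y.1)
        (mem_below_of_mem_fan h) (inr_mem_below _ _)
    · rw [List.mem_singleton] at h
      have := congrArg age h
      simp [hzdef] at this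
      omega
  have hage : ∀ v ∈ path x, v ∉ Below y.1 := fun v hv hv' => by
    have h₁ := hx₅ v hv
    have h₂ := age_of_mem_below hv'
    omega
  refine hc (path x ++ [corner w i]) (path y ++ [z]) ?_ ?_ (by simp [path])
    (by simp only [List.map_append, hw]; simp [hz])
  · have h₁ : (path y ++ [z]).IsChain apollonian.Adj := by
      refine List.isChain_append.2 ⟨hy₁, List.isChain_singleton _, fun a ha b hb => ?_⟩
      simp only [List.head?_cons, Option.mem_def, Option.some.injEq] at hb
      simp only [path, List.getLast?_append, List.getLast?_singleton, Option.some_or,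
        Option.mem_def, Option.some.injEq] at ha
      subst ha; subst hb
      have := adj_corner_of_notMem hyv (y.2.1 :: y.1)
      rw [corner_cons_self] at this
      exact this.symm
    have h₂ : (corner w i :: (path y ++ [z])).IsChain apollonian.Adj := by
      refine List.isChain_cons.2 ⟨fun a ha => ?_, h₁⟩
      refine (hy₃ a ?_).symm
      have hne : path y ≠ [] := by simp [path]
      rw [List.head?_append_of_ne_nil _ hne] at ha
      exact List.mem_of_mem_head? ha
    rw [List.append_assoc, List.singleton_append]
    refine isChain_append_of_forall hx₁ h₂ fun v hv a ha => ?_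
    simp only [List.head?_cons, Option.mem_def, Option.some.injEq] at ha
    subst ha
    exact hx₃ v hv
  · rw [List.append_assoc, List.singleton_append]
    refine List.nodup_append.2 ⟨hx₂, List.nodup_cons.2 ⟨?_, List.nodup_append.2
      ⟨hy₂, List.nodup_singleton _, ?_⟩⟩, ?_⟩
    · rw [List.mem_append, List.mem_singleton, not_or]
      refine ⟨hpy, fun h => corner_notMem_below w i ?_⟩
      rw [h]
      rw [hyu] at hzB
      exact below_append _ _ hzB
    · intro a ha b hb hab
      rw [List.mem_singleton] at hb
      exact hzy (hb ▸ hab ▸ ha)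
    · intro a ha b hb hab
      subst hab
      rw [List.mem_cons, List.mem_append, List.mem_singleton] at hb
      rcases hb with rfl | hb | rfl
      · exact hpx ha
      · exact hage _ ha (hy₄ _ hb)
      · exact hage _ ha hzB

/-! ### Palettes of fans and of links -/

open Classical in
/-- The colors on the fan in `w` around the two corners with index different from `l`. -/
noncomputable def fanColors (c : Vtx → Fin 10) (w : List (Fin 3)) (l : Fin 3) : Finset (Fin 10) :=
  Finset.univ.filter fun x => ∃ a, c (fanVtx l w a) = x

open Classical in
/-- The colors of the neighbors, inside `w`, of the `i`-th corner of `w`. -/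
noncomputable def linkColors (c : Vtx → Fin 10) (w : List (Fin 3)) (i : Fin 3) :
    Finset (Fin 10) :=
  Finset.univ.filter fun x => ∃ u, i ∉ u ∧ c (Sum.inr (u ++ w)) = x

lemma mem_fanColors {w : List (Fin 3)} {l : Fin 3} {x : Fin 10} :
    x ∈ fanColors c w l ↔ ∃ a, c (fanVtx l w a) = x := by
  simp [fanColors]

lemma mem_linkColors {w : List (Fin 3)} {i : Fin 3} {x : Fin 10} :
    x ∈ linkColors c w i ↔ ∃ u, i ∉ u ∧ c (Sum.inr (u ++ w)) = x := by
  simp [linkColors]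

lemma fanVtx_mem_fanColors (w : List (Fin 3)) (l : Fin 3) (a : ℕ) :
    c (fanVtx l w a) ∈ fanColors c w l :=
  mem_fanColors.2 ⟨a, rfl⟩

lemma notMem_replicate {i l : Fin 3} (h : i ≠ l) (a : ℕ) : i ∉ List.replicate a l := by
  simp [List.mem_replicate, h]

lemma fanColors_subset_linkColors {w v : List (Fin 3)} {i l : Fin 3} (hil : i ≠ l) (hv : i ∉ v) :
    fanColors c (v ++ w) l ⊆ linkColors c w i := by
  intro x hx
  obtain ⟨a, rfl⟩ := mem_fanColors.1 hx
  refine mem_linkColors.2 ⟨List.replicate a l ++ v, ?_, by rw [fanVtx, List.append_assoc]⟩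
  rw [List.mem_append, not_or]
  exact ⟨notMem_replicate hil a, hv⟩

lemma fanColors_replicate_subset (w : List (Fin 3)) (l : Fin 3) (b : ℕ) :
    fanColors c (List.replicate b l ++ w) l ⊆ fanColors c w l := by
  intro x hx
  obtain ⟨a, rfl⟩ := mem_fanColors.1 hx
  rw [fanVtx_add]
  exact fanVtx_mem_fanColors _ _ _

lemma NoLongSquare.fan_ne_succ (hc : NoLongSquare k c) (l : Fin 3) (w : List (Fin 3)) (a : ℕ) :
    c (fanVtx l w (a + 1)) ≠ c (fanVtx l w a) := by
  have := hc.ne_corner (List.replicate (a + 1) l ++ w) (i := l) (u := []) (by simp)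
  rwa [List.replicate_succ, List.cons_append, corner_cons_self] at this

lemma NoLongSquare.fan_ne_corner (hc : NoLongSquare k c) {i l : Fin 3} (h : i ≠ l)
    (w : List (Fin 3)) (a : ℕ) : c (fanVtx l w a) ≠ c (corner w i) :=
  hc.ne_corner w (notMem_replicate h a)

lemma map_fan (l : Fin 3) (w : List (Fin 3)) (n : ℕ) :
    (fan l w n).map c = (List.range n).map fun a => c (fanVtx l w a) := by
  rw [fan_eq, List.map_map]
  rfl

lemma add_mul_eq_of_periodic {α : Type*} {f : ℕ → α} {P : ℕ} (h : ∀ a, f (a + P) = f a)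
    (a q : ℕ) : f (a + P * q) = f a := by
  induction q with
  | zero => rfl
  | succ q ih => rw [Nat.mul_succ, ← add_assoc, h, ih]

lemma NoLongSquare.fan_not_periodic (hc : NoLongSquare k c) (l : Fin 3) (w : List (Fin 3))
    {P : ℕ} (hP : 0 < P) : ¬ ∀ a, c (fanVtx l w (a + P)) = c (fanVtx l w a) := by
  intro h
  have hk : k < P * (k + 1) := by nlinarith
  refine hc (fan l w (P * (k + 1))) (fan l (List.replicate (P * (k + 1)) l ++ w) (P * (k + 1)))
    ?_ ?_ (by simpa using hk) ?_
  · rw [← fan_add]; exact isChain_fan _ _ _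
  · rw [← fan_add]; exact nodup_fan _ _ _
  · rw [map_fan, map_fan]
    refine List.map_congr_left fun a _ => ?_
    rw [fanVtx_add, add_comm]
    exact (add_mul_eq_of_periodic (f := fun a => c (fanVtx l w a)) h a (k + 1)).symm

lemma NoLongSquare.three_le_fanColors (hc : NoLongSquare k c) (w : List (Fin 3)) (l : Fin 3) :
    3 ≤ (fanColors c w l).card := by
  by_contra hlt
  refine hc.fan_not_periodic l w two_pos fun a => ?_
  by_contra hne
  exact hlt (Finset.two_lt_card.2 ⟨_, fanVtx_mem_fanColors w l a, _,
    fanVtx_mem_fanColors w l (a + 1), _, fanVtx_mem_fanColors w l (a + 2),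
    (hc.fan_ne_succ l w a).symm, fun h => hne h.symm, (hc.fan_ne_succ l w (a + 1)).symm⟩)

/-! ### Descending walks -/

/-- Let the `m`-th corner of `w` be clean. A descending walk can continue from it to any of its
neighbors `x` inside `w`, and then into a face in which `x` is a clean corner and the color of the
previous vertex does not occur around `x`. -/
lemma NoLongSquare.exists_step (hc : NoLongSquare k c) {w u : List (Fin 3)} {m r : Fin 3}
    (hu : m ∉ u) (hw : Clean c w m) (hmr : m ≠ r) :
    ∃ t : List (Fin 3), (∀ n, n ≠ r → n ∉ t) ∧ Clean c (t ++ m :: (u ++ w)) m ∧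
      ∀ v, m ∉ v → c (Sum.inr (v ++ (t ++ m :: (u ++ w)))) ≠ c (corner w m) := by
  obtain ⟨b, hb⟩ := hc.exists_clean (m :: (u ++ w)) hmr
  refine ⟨List.replicate b r, fun n hn => notMem_replicate hn b, hb, fun v hv => ?_⟩
  rw [← List.append_assoc]
  exact hw u hu m _ (by simp [hv, notMem_replicate hmr b])

lemma corner_append_cons_self {m : Fin 3} {t : List (Fin 3)} (ht : m ∉ t) (w : List (Fin 3)) :
    corner (t ++ m :: w) m = Sum.inr w := by
  rw [corner_append ht, corner_cons_self]

lemma below_step (t u w : List (Fin 3)) (m : Fin 3) : Below (t ++ m :: (u ++ w)) ⊆ Below w := by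
  have := below_append (t ++ m :: u) w
  simpa using this

/-- If all fans have at least `e` colors, then all links have at least `e + 3`. Otherwise each fan
inside the link has all colors of the link except those of its second hub and of the vertex before
it, so that inside the link one can descend along a word of period `3`. -/
lemma NoLongSquare.add_three_le_linkColors (hc : NoLongSquare k c) {e : ℕ} (he : 0 < e)
    (hE : ∀ w l, e ≤ (fanColors c w l).card) (w : List (Fin 3)) (i : Fin 3) :
    e + 3 ≤ (linkColors c w i).card := by
  by_contra hlt
  obtain ⟨m, r, him, hir, hmr⟩ : ∃ m r : Fin 3, i ≠ m ∧ i ≠ r ∧ m ≠ r :=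
    ⟨third i i, third i (third i i), (third_ne_left _ _).symm, (third_ne_left _ _).symm,
      (third_ne_right _ _).symm⟩
  have hfan : ∀ v, i ∉ v → ∀ τ ∈ linkColors c w i, τ ∉ fanColors c (v ++ w) r →
      c (corner (v ++ w) m) ∈ linkColors c w i → c (corner (v ++ w) m) ≠ τ →
      ∀ x ∈ linkColors c w i, x ≠ c (corner (v ++ w) m) → x ≠ τ →
        x ∈ fanColors c (v ++ w) r := by
    intro v hv τ hτ hτF hσ hστ x hx hxσ hxτ
    have hsub : fanColors c (v ++ w) r ⊆
        ((linkColors c w i).erase (c (corner (v ++ w) m))).erase τ := by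
      intro y hy
      refine Finset.mem_erase.2 ⟨fun h => hτF (h ▸ hy), Finset.mem_erase.2 ⟨?_,
        fanColors_subset_linkColors hir hv hy⟩⟩
      obtain ⟨a, rfl⟩ := mem_fanColors.1 hy
      exact hc.fan_ne_corner hmr _ a
    have hcard : (((linkColors c w i).erase (c (corner (v ++ w) m))).erase τ).card ≤
        (fanColors c (v ++ w) r).card := by
      rw [Finset.card_erase_of_mem (Finset.mem_erase.2 ⟨hστ.symm, hτ⟩),
        Finset.card_erase_of_mem hσ]
      have := hE (v ++ w) r
      omega
    rw [Finset.eq_of_subset_of_card_le hsub hcard]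
    exact Finset.mem_erase.2 ⟨hxτ, Finset.mem_erase.2 ⟨hxσ, hx⟩⟩
  have walk : ∀ s : ℕ → Fin 10, (∀ t, s t ∈ linkColors c w i) → (∀ t, s (t + 1) ≠ s t) →
      (∀ t, s (t + 2) ≠ s t) → ∀ N t v, i ∉ v → Clean c (v ++ w) m →
      c (corner (v ++ w) m) = s (t + 1) → s t ∉ fanColors c (v ++ w) r →
      ∃ W : List Vtx, W.map c = (List.range N).map (fun q => s (t + 2 + q)) ∧
        (corner (v ++ w) m :: W).IsChain apollonian.Adj ∧ W.Nodup ∧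
        ∀ x ∈ W, x ∈ Below (v ++ w) := by
    intro s hsV hs1 hs2 N
    induction N with
    | zero =>
      intro t v _ _ _ _
      exact ⟨[], by simp, List.isChain_singleton _, List.nodup_nil, by simp⟩
    | succ N ih =>
      intro t v hv hcl hσ hτ
      have hmem := hfan v hv (s t) (hsV t) hτ (hσ ▸ hsV (t + 1)) (hσ ▸ hs1 t) (s (t + 2))
        (hsV _) (hσ ▸ hs1 (t + 1)) (hs2 t)
      obtain ⟨a, ha⟩ := mem_fanColors.1 hmem
      have hma := notMem_replicate hmr a
      obtain ⟨t', ht', hcl', hprev⟩ := hc.exists_step hma hcl hmr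
      set v' := t' ++ m :: (List.replicate a r ++ v) with hv'
      have hassoc : t' ++ m :: (List.replicate a r ++ (v ++ w)) = v' ++ w := by simp [hv']
      have hco : corner (v' ++ w) m = fanVtx r (v ++ w) a := by
        rw [← hassoc, corner_append_cons_self (ht' m hmr), fanVtx]
      have hiv' : i ∉ v' := by simp [hv', ht' i hir, him, notMem_replicate hir a, hv]
      rw [hassoc] at hcl' hprev
      obtain ⟨W, hWc, hWch, hWn, hWB⟩ := ih (t + 1) v' hiv' hcl' (by rw [hco, ha]) (by
        intro h
        obtain ⟨b, hb⟩ := mem_fanColors.1 h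
        exact hprev _ (notMem_replicate hmr b) (hb.trans hσ.symm))
      rw [hco] at hWch
      have hB : Below (v' ++ w) ⊆ Below (v ++ w) := by
        rw [← hassoc]; exact below_step _ _ _ _
      refine ⟨fanVtx r (v ++ w) a :: W, ?_, ?_, ?_, ?_⟩
      · rw [List.map_cons, List.range_succ_eq_map, List.map_cons, List.map_map, ha, hWc]
        congr 1
        refine List.map_congr_left fun q _ => ?_
        show s (t + 1 + 2 + q) = s (t + 2 + (q + 1))
        congr 1; omega
      · rw [List.isChain_cons_cons]
        exact ⟨(fanVtx_adj hmr _ a).symm, hWch⟩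
      · refine List.nodup_cons.2 ⟨fun h => ?_, hWn⟩
        have := hWB _ h
        rw [← hco] at this
        exact corner_notMem_below _ _ this
      · intro x hx
        rcases List.mem_cons.1 hx with rfl | hx
        · exact inr_mem_below _ _
        · exact hB (hWB x hx)
  -- The first two steps of the descent: `inr w`, then the vertex stacked in `v₀ ++ w`.
  obtain ⟨b, hb⟩ := hc.exists_clean (m :: w) hmr
  set v₀ := List.replicate b r ++ [m] with hv₀
  have hbv : List.replicate b r ++ m :: w = v₀ ++ w := by simp [hv₀]
  rw [hbv] at hb
  have hco₀ : corner (v₀ ++ w) m = Sum.inr w := by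
    rw [← hbv, corner_append_cons_self (notMem_replicate hmr b)]
  have hiv₀ : i ∉ v₀ := by simp [hv₀, notMem_replicate hir b, him]
  obtain ⟨t, ht, hcl, hprev⟩ := hc.exists_step (u := []) (by simp) hb hmr
  set v₁ := t ++ m :: v₀ with hv₁
  have htv : t ++ m :: ([] ++ (v₀ ++ w)) = v₁ ++ w := by simp [hv₁]
  have hco₁ : corner (v₁ ++ w) m = Sum.inr (v₀ ++ w) := by
    rw [← htv, corner_append_cons_self (ht m hmr)]; rfl
  have hiv₁ : i ∉ v₁ := by simp [hv₁, ht i hir, him, hiv₀]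
  rw [htv] at hcl hprev
  rw [hco₀] at hprev
  set τ := c (Sum.inr w) with hτ
  set σ := c (Sum.inr (v₀ ++ w)) with hσ
  have hτV : τ ∈ linkColors c w i := mem_linkColors.2 ⟨[], by simp, rfl⟩
  have hσV : σ ∈ linkColors c w i := mem_linkColors.2 ⟨v₀, hiv₀, rfl⟩
  have hτF : τ ∉ fanColors c (v₁ ++ w) r := by
    intro h
    obtain ⟨a, ha⟩ := mem_fanColors.1 h
    exact hprev _ (notMem_replicate hmr a) ha
  have hστ : σ ≠ τ := by
    have := hc.ne_corner (v₀ ++ w) (i := m) (u := []) (by simp)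
    rwa [hco₀] at this
  obtain ⟨γ, hγ⟩ : (fanColors c (v₁ ++ w) r).Nonempty :=
    Finset.card_pos.1 (he.trans_le (hE _ _))
  have hγV := fanColors_subset_linkColors hir hiv₁ hγ
  have hγτ : γ ≠ τ := fun h => hτF (h ▸ hγ)
  have hγσ : γ ≠ σ := by
    obtain ⟨a, rfl⟩ := mem_fanColors.1 hγ
    have := hc.fan_ne_corner hmr (v₁ ++ w) a
    rwa [hco₁] at this
  let s : ℕ → Fin 10 := fun t => if t % 3 = 0 then τ else if t % 3 = 1 then σ else γ
  have hper : ∀ t, s (t + 3) = s t := fun t => by simp [s]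
  have hs : ∀ t, s t ∈ linkColors c w i ∧ s (t + 1) ≠ s t ∧ s (t + 2) ≠ s t := by
    intro t
    have h3 : t % 3 = 0 ∨ t % 3 = 1 ∨ t % 3 = 2 := by omega
    rcases h3 with h | h | h <;>
      simp [s, h, Nat.add_mod, hτV, hσV, hγV, hστ, hγτ, hγσ, hστ.symm, hγτ.symm, hγσ.symm]
  obtain ⟨W, hWc, hWch, hWn, -⟩ := walk s (fun t => (hs t).1) (fun t => (hs t).2.1)
    (fun t => (hs t).2.2) (3 * (k + 1) + 3 * (k + 1)) 0 v₁ hiv₁ hcl (by rw [hco₁]; simp [s, hσ])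
    (by simpa [s] using hτF)
  rw [List.range_add, List.map_append] at hWc
  obtain ⟨A, B, rfl, hA, hB⟩ := List.map_eq_append_iff.1 hWc
  refine hc A B hWch.tail hWn ?_ ?_
  · have := congrArg List.length hA
    simp at this
    omega
  · rw [hA, hB, List.map_map]
    refine List.map_congr_left fun q _ => ?_
    show s (0 + 2 + q) = s (0 + 2 + (3 * (k + 1) + q))
    rw [← add_mul_eq_of_periodic hper (0 + 2 + q) (k + 1)]
    congr 1; omega

/-! ### Two synchronous walks -/

lemma NoLongSquare.six_le_linkColors (hc : NoLongSquare k c) (w : List (Fin 3)) (i : Fin 3) :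
    6 ≤ (linkColors c w i).card :=
  hc.add_three_le_linkColors (by norm_num) hc.three_le_fanColors w i

/-- Two descending walks with the same color word, of any length: the walk `W` stays in the
neighborhood of the `n`-th corner of `w`, the walk `W'` is only required to stay inside `v`.
Both must avoid the current color and the previous color `τ`; of the remaining eight colors, `W`
has a choice of three at least and `W'` of six at least, so that some choice is common. -/
lemma NoLongSquare.exists_synchronous_walks (hc : NoLongSquare k c) {n m r j : Fin 3}
    (hnm : n ≠ m) (hnr : n ≠ r) (hmr : m ≠ r) (N : ℕ) (w v : List (Fin 3)) (τ : Fin 10)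
    (hw : Clean c w m) (hτw : τ ∉ fanColors c w r) (hv : Clean c v j)
    (hτv : τ ∉ linkColors c v j) (hσ : c (corner w m) = c (corner v j))
    (hτ : τ ≠ c (corner w m)) :
    ∃ W W' : List Vtx, W.length = N ∧ W.map c = W'.map c ∧
      (corner w m :: W).IsChain apollonian.Adj ∧ (corner v j :: W').IsChain apollonian.Adj ∧
      (∀ x ∈ W, apollonian.Adj x (corner w n)) ∧ W.Nodup ∧ W'.Nodup ∧
      (∀ x ∈ W, x ∈ Below w) ∧ ∀ x ∈ W', x ∈ Below v := by
  induction N generalizing w v τ with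
  | zero =>
    exact ⟨[], [], rfl, rfl, List.isChain_singleton _, List.isChain_singleton _, by simp,
      List.nodup_nil, List.nodup_nil, by simp, by simp⟩
  | succ N ih =>
    obtain ⟨θ, hθ⟩ : (fanColors c w r ∩ linkColors c v j).Nonempty := by
      rw [← Finset.card_pos]
      have h₁ := Finset.card_union_add_card_inter (fanColors c w r) (linkColors c v j)
      have h₂ := hc.three_le_fanColors w r
      have h₃ := hc.six_le_linkColors v j
      have hsub : fanColors c w r ∪ linkColors c v j ⊆
          ((Finset.univ : Finset (Fin 10)).erase (c (corner w m))).erase τ := by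
        intro x hx
        rw [Finset.mem_erase, Finset.mem_erase]
        rcases Finset.mem_union.1 hx with hx | hx
        · refine ⟨fun h => hτw (h ▸ hx), ?_, Finset.mem_univ _⟩
          obtain ⟨a, rfl⟩ := mem_fanColors.1 hx
          exact hc.fan_ne_corner hmr w a
        · refine ⟨fun h => hτv (h ▸ hx), ?_, Finset.mem_univ _⟩
          obtain ⟨u, hu, rfl⟩ := mem_linkColors.1 hx
          rw [hσ]
          exact hc.ne_corner v hu
      have h₄ := Finset.card_le_card hsub
      rw [Finset.card_erase_of_mem (Finset.mem_erase.2 ⟨hτ, Finset.mem_univ _⟩),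
        Finset.card_erase_of_mem (Finset.mem_univ _), Finset.card_univ, Fintype.card_fin] at h₄
      omega
    obtain ⟨hθw, hθv⟩ := Finset.mem_inter.1 hθ
    obtain ⟨a, rfl⟩ := mem_fanColors.1 hθw
    obtain ⟨u, hu, hua⟩ := mem_linkColors.1 hθv
    obtain ⟨t, ht, htcl, htprev⟩ := hc.exists_step (notMem_replicate hmr a) hw hmr
    obtain ⟨t', ht', htcl', htprev'⟩ := hc.exists_step hu hv (third_ne_left j j).symm
    have hco := corner_append_cons_self (ht m hmr) (List.replicate a r ++ w)
    have hco' := corner_append_cons_self (ht' j (third_ne_left j j).symm) (u ++ v)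
    have hhub : corner (t ++ m :: (List.replicate a r ++ w)) n = corner w n := by
      rw [corner_append (ht n hnr), corner_cons_of_ne hnm,
        corner_append (notMem_replicate hnr a)]
    obtain ⟨W, W', hN, hWW, hWc, hWc', hWh, hWn, hWn', hWB, hWB'⟩ :=
      ih (t ++ m :: (List.replicate a r ++ w)) (t' ++ j :: (u ++ v)) (c (corner w m)) htcl
        (fun h => by
          obtain ⟨b, hb⟩ := mem_fanColors.1 h
          exact htprev _ (notMem_replicate hmr b) hb) htcl'
        (fun h => by
          obtain ⟨b, hb, hbc⟩ := mem_linkColors.1 h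
          exact htprev' b hb (hbc.trans hσ)) (by rw [hco, hco', hua]; rfl)
        (by rw [hco]; exact (hc.fan_ne_corner hmr w a).symm)
    rw [hco] at hWc
    rw [hco'] at hWc'
    rw [hhub] at hWh
    refine ⟨fanVtx r w a :: W, Sum.inr (u ++ v) :: W', by simp [hN], by simp [hWW, hua],
      List.isChain_cons_cons.2 ⟨(fanVtx_adj hmr w a).symm, hWc⟩,
      List.isChain_cons_cons.2 ⟨(adj_corner_of_notMem hu v).symm, hWc'⟩, ?_,
      List.nodup_cons.2 ⟨fun h => ?_, hWn⟩, List.nodup_cons.2 ⟨fun h => ?_, hWn'⟩, ?_, ?_⟩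
    · intro x hx
      rcases List.mem_cons.1 hx with rfl | hx
      · exact fanVtx_adj hnr w a
      · exact hWh x hx
    · have := hWB _ h
      rw [fanVtx, ← hco] at this
      exact corner_notMem_below _ _ this
    · have := hWB' _ h
      rw [← hco'] at this
      exact corner_notMem_below _ _ this
    · intro x hx
      rcases List.mem_cons.1 hx with rfl | hx
      · exact inr_mem_below _ _
      · exact below_step _ _ _ _ (hWB x hx)
    · intro x hx
      rcases List.mem_cons.1 hx with rfl | hx
      · exact inr_mem_below _ _
      · exact below_step _ _ _ _ (hWB' x hx)

/-- Let `x`, `y` be two corners of the face `g`, and let `y` also be a clean corner of a disjoint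
face `g'`. If `x` has another neighbor `y'` with the color of `y`, then `y` has no neighbor `z`
inside `g'` with the color of `x`: synchronous walks `W` from `x` inside `g`, in the neighborhood
of `y`, and `W'` from `z` inside `g'` would give the square `(y' x W) (y z W')`. -/
lemma NoLongSquare.notMem_linkColors (hc : NoLongSquare k c) {m n j : Fin 3} (hmn : m ≠ n)
    {g g' : List (Fin 3)} {x y y' : Vtx} (hx : corner g m = x) (hy : corner g n = y)
    (hy₂ : corner g' j = y) (hg' : Clean c g' j) (hadj : apollonian.Adj y' x)
    (hcy : c y' = c y) (hne : y' ≠ y) (hy'g : y' ∉ Below g) (hy'g' : y' ∉ Below g')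
    (hxg' : x ∉ Below g') (hdisj : Disjoint (Below g) (Below g')) :
    c x ∉ linkColors c g' j := by
  intro hmem
  obtain ⟨u, hu, hz⟩ := mem_linkColors.1 hmem
  obtain ⟨r, hmr, hnr⟩ : ∃ r, m ≠ r ∧ n ≠ r :=
    ⟨third m n, (third_ne_left m n).symm, (third_ne_right m n).symm⟩
  have hxy : c x ≠ c y := by rw [← hx, ← hy]; exact hc.corner_ne g hmn
  obtain ⟨b, hb⟩ := hc.exists_clean g hmr
  have hbx : corner (List.replicate b r ++ g) m = x := by
    rw [corner_append (notMem_replicate hmr b), hx]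
  have hby : corner (List.replicate b r ++ g) n = y := by
    rw [corner_append (notMem_replicate hnr b), hy]
  obtain ⟨t, ht, htcl, htprev⟩ := hc.exists_step hu hg' (third_ne_left j j).symm
  have hco := corner_append_cons_self (ht j (third_ne_left j j).symm) (u ++ g')
  obtain ⟨W, W', hN, hWW, hWc, hWc', hWh, hWn, hWn', hWB, hWB'⟩ :=
    hc.exists_synchronous_walks hmn.symm hnr hmr (k + 1) (List.replicate b r ++ g)
      (t ++ j :: (u ++ g')) (c y) hb
      (fun h => by
        obtain ⟨a, ha⟩ := mem_fanColors.1 h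
        exact hc.fan_ne_corner hnr _ a (ha.trans (by rw [hby])))
      htcl
      (fun h => by
        obtain ⟨v, hv, hvc⟩ := mem_linkColors.1 h
        exact htprev v hv (hvc.trans (by rw [hy₂]))) (by rw [hco, hbx, hz])
      (by rw [hbx]; exact hxy.symm)
  rw [hbx] at hWc
  rw [hby] at hWh
  rw [hco] at hWc'
  set z : Vtx := Sum.inr (u ++ g') with hzdef
  have hzB : z ∈ Below g' := inr_mem_below _ _
  have hyg' : y ∉ Below g' := hy₂ ▸ corner_notMem_below g' j
  have hyg : y ∉ Below g := hy ▸ corner_notMem_below g n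
  have hxg : x ∉ Below g := hx ▸ corner_notMem_below g m
  have hWg : ∀ a ∈ W, a ∈ Below g := fun a ha => below_append _ _ (hWB a ha)
  have hWg' : ∀ a ∈ W', a ∈ Below g' := fun a ha => below_step _ _ _ _ (hWB' a ha)
  have hzW' : z ∉ W' := fun h => by
    have := hWB' z h
    rw [← hco] at this
    exact corner_notMem_below _ _ this
  have hyz : apollonian.Adj y z := by
    rw [← hy₂]; exact (adj_corner_of_notMem hu g').symm
  refine hc (y' :: x :: W) (y :: z :: W') ?_ ?_ (by simp [hN]; omega) (by simp [hcy, hz, hWW])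
  · obtain ⟨a, W₀, rfl⟩ : ∃ a W₀, W = a :: W₀ := by
      cases W with
      | nil => simp at hN
      | cons a W₀ => exact ⟨a, W₀, rfl⟩
    have h₁ : (y :: z :: W').IsChain apollonian.Adj := List.isChain_cons_cons.2 ⟨hyz, hWc'⟩
    have h₂ := isChain_append_of_forall hWc.tail h₁ (fun a ha b hb => by
      simp only [List.head?_cons, Option.mem_def, Option.some.injEq] at hb
      subst hb
      exact hWh a ha)
    exact List.isChain_cons_cons.2 ⟨hadj, List.isChain_cons_cons.2
      ⟨(List.isChain_cons_cons.1 hWc).1, h₂⟩⟩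
  · have hxne : x ≠ y := fun h => hxy (h ▸ rfl)
    have hxz : x ≠ z := fun h => hxg' (h ▸ hzB)
    have hy'z : y' ≠ z := fun h => hy'g' (h ▸ hzB)
    have hgg : ∀ a, a ∈ Below g → a ∉ Below g' := fun _ h => Set.disjoint_left.1 hdisj h
    refine List.nodup_append.2 ⟨?_, ?_, ?_⟩
    · simp only [List.nodup_cons, List.mem_cons, not_or]
      exact ⟨⟨hadj.ne, fun h => hy'g (hWg _ h)⟩, fun h => hxg (hWg _ h), hWn⟩
    · simp only [List.nodup_cons, List.mem_cons, not_or]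
      exact ⟨⟨hyz.ne, fun h => hyg' (hWg' _ h)⟩, hzW', hWn'⟩
    · intro a ha b hb hab
      subst hab
      simp only [List.mem_cons] at ha hb
      rcases ha with rfl | rfl | ha <;> rcases hb with rfl | rfl | hb
      · exact hne rfl
      · exact hy'z rfl
      · exact hy'g' (hWg' _ hb)
      · exact hxne rfl
      · exact hxz rfl
      · exact hxg' (hWg' _ hb)
      · exact hyg (hWg _ ha)
      · exact hgg _ (hWg _ ha) hzB
      · exact hgg _ (hWg _ ha) (hWg' _ hb)

/-! ### The neighbors along a fan -/

/-- Let `V a` miss at most one color outside a set `S a`, let `f (a - 1)` and `f (a + 1)` lie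
outside `S a`, and suppose that for consecutive `a` one of `f a`,
`f (a + 1)` is missing from the set of the other one, and that `f (a + 1)` is missing from both
`V a` and `V (a + 2)` when `f a = f (a + 2)`. Then the condition `f a = f (a + 2)` holds for all
large `a` or for no large `a`. -/
lemma eventually_eq_or_ne {α : Type*} {f : ℕ → α} {V S : ℕ → Finset α}
    (hmiss : ∀ a, ∀ x ∉ S a, ∀ y ∉ S a, x ∉ V a → y ∉ V a → x = y)
    (hnext : ∀ a, f (a + 1) ∉ S a) (hprev : ∀ a, f a ∉ S (a + 1))
    (hor : ∀ a, f (a + 1) ∉ V a ∨ f a ∉ V (a + 1))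
    (hleft : ∀ a, f a = f (a + 2) → f (a + 1) ∉ V a)
    (hright : ∀ a, f a = f (a + 2) → f (a + 1) ∉ V (a + 2)) :
    (∃ a₀, ∀ a ≥ a₀, f a = f (a + 2)) ∨ ∃ a₀, ∀ a ≥ a₀, f a ≠ f (a + 2) := by
  by_contra hcon
  push Not at hcon
  obtain ⟨hcon₁, hcon₂⟩ := hcon
  obtain ⟨a, -, ha⟩ := hcon₂ 0
  -- To the right of a repetition, each set misses the color before it.
  have hdir : ∀ d, f (a + d + 1) ∉ V (a + d + 2) := by
    intro d
    induction d with
    | zero => exact hright a ha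
    | succ d ih =>
      rw [show a + (d + 1) = a + d + 1 by omega]
      rcases hor (a + d + 2) with h | h
      · exact hright (a + d + 1) (hmiss _ _ (hprev _) _ (hnext _) ih h)
      · exact h
  -- So repetitions propagate to the left, back to the first one.
  have hback : ∀ d, f (a + d + 1) = f (a + d + 3) → f (a + d) = f (a + d + 2) := by
    intro d hd
    cases d with
    | zero => exact ha
    | succ d => exact hmiss _ _ (hprev _) _ (hnext _) (hdir d) (hleft (a + d + 2) hd)
  have hall : ∀ e d, f (a + d + e) = f (a + d + e + 2) → f (a + d) = f (a + d + 2) := by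
    intro e
    induction e with
    | zero => exact fun d h => h
    | succ e ih =>
      intro d h
      have := hback (d + e)
      rw [← add_assoc] at this
      exact ih d (this h)
  obtain ⟨b, hb, hbne⟩ := hcon₁ a
  obtain ⟨b', hb', hbb⟩ := hcon₂ b
  obtain ⟨d, rfl⟩ := Nat.exists_eq_add_of_le hb
  obtain ⟨e, rfl⟩ := Nat.exists_eq_add_of_le hb'
  exact hbne (hall e d hbb)

/-- Each vertex of the fan of two clean hubs becomes a clean corner of some face off the fan; let
`V a` be the set of colors of the neighbors of the `a`-th vertex inside that face. These sets avoid
the colors of the hubs and of the vertex itself, and the exchange principle applies to consecutive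
vertices of the fan. If the vertices before and after the `(a + 1)`-st have the same color, they
can also take the role of the further neighbor in it for each other. -/
lemma NoLongSquare.fan_dichotomy (hc : NoLongSquare k c) {i j l : Fin 3} (hij : i ≠ j)
    (hil : i ≠ l) (hjl : j ≠ l) {w : List (Fin 3)} (hi : Clean c w i) (hj : Clean c w j) :
    ∃ V : ℕ → Finset (Fin 10),
      (∀ a, V a ⊆ {c (corner w i), c (corner w j), c (fanVtx l w a)}ᶜ) ∧
      (∀ a, ∃ g m, V a = linkColors c g m) ∧
      (∀ a, c (fanVtx l w (a + 1)) ∉ V a ∨ c (fanVtx l w a) ∉ V (a + 1)) ∧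
      (∀ a, c (fanVtx l w a) = c (fanVtx l w (a + 2)) →
        c (fanVtx l w (a + 1)) ∉ V a ∧ c (fanVtx l w (a + 1)) ∉ V (a + 2)) := by
  have hrep : ∀ m, m ≠ l → ∀ a, m ∉ List.replicate a l := fun m hm a => notMem_replicate hm a
  choose b hb using fun a => hc.exists_clean (j :: (List.replicate a l ++ w)) hjl
  set g : ℕ → List (Fin 3) := fun a => List.replicate (b a) l ++ j :: (List.replicate a l ++ w)
    with hg
  have hgco : ∀ a, corner (g a) j = fanVtx l w a := fun a =>
    corner_append_cons_self (hrep j hjl _) _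
  have hco : ∀ a, corner (List.replicate (a + 1) l ++ w) l = fanVtx l w a := fun a => by
    rw [List.replicate_succ, List.cons_append, corner_cons_self, fanVtx]
  have hgB : ∀ a, Below (g a) ⊆ Below (j :: (List.replicate a l ++ w)) := fun a =>
    below_append _ _
  have hfanB : ∀ a, fanVtx l w a ∈ Below (List.replicate a l ++ w) := fun a =>
    inr_mem_below_self _
  have hlB : ∀ a, Below (List.replicate (a + 1) l ++ w) ⊆
      Below (l :: (List.replicate a l ++ w)) := fun a => by
    rw [List.replicate_succ, List.cons_append]
  have hage : ∀ a, age (fanVtx l w a) = a + w.length + 1 := fun a => by simp [fanVtx]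
  have hglen : ∀ a, a + w.length + 1 ≤ (g a).length := fun a => by simp [hg]
  have hjB : ∀ a, Disjoint (Below (g a)) (Below (List.replicate (a + 1) l ++ w)) := fun a =>
    ((below_cons_disjoint hjl _).mono_left (hgB a)).mono_right (hlB a)
  have hiB : ∀ a, Disjoint (Below (i :: (List.replicate a l ++ w)))
      (Below (List.replicate (a + 1) l ++ w)) := fun a =>
    (below_cons_disjoint hil _).mono_right (hlB a)
  refine ⟨fun a => linkColors c (g a) j, fun a x hx => ?_, fun a => ⟨_, _, rfl⟩, fun a => ?_,
    fun a haa => ⟨?_, ?_⟩⟩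
  · obtain ⟨u, hu, rfl⟩ := mem_linkColors.1 hx
    have hju : j ∉ u ++ List.replicate (b a) l := by simp [hu, hrep j hjl]
    simp only [Finset.mem_compl, Finset.mem_insert, Finset.mem_singleton, not_or]
    refine ⟨?_, ?_, ?_⟩
    · have := hi (List.replicate a l) (hrep i hil a) j _ hju
      simpa [hg] using this
    · have := hj (List.replicate a l) (hrep j hjl a) j _ hju
      simpa [hg] using this
    · rw [← hgco]
      exact hc.ne_corner _ hu
  · rw [or_iff_not_imp_left, not_not]
    intro hmem
    obtain ⟨u, hu, hy'⟩ := mem_linkColors.1 hmem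
    have hy'g : (Sum.inr (u ++ g a) : Vtx) ∉ Below (List.replicate (a + 1) l ++ w) :=
      Set.disjoint_left.1 (hjB a) (inr_mem_below _ _)
    refine hc.notMem_linkColors (g := i :: (List.replicate (a + 1) l ++ w)) (m := l) (n := i)
      hil.symm (y := fanVtx l w (a + 1)) (y' := Sum.inr (u ++ g a)) ?_ (corner_cons_self _ _)
      (hgco _) (hb _) ?_ hy' ?_ ?_ ?_ ?_ ?_
    · rw [corner_cons_of_ne hil.symm, hco]
    · rw [← hgco]; exact adj_corner_of_notMem hu _
    · exact fun h => hy'g (h ▸ hfanB (a + 1))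
    · exact fun h => hy'g (below_cons _ _ h)
    · exact fun h => hy'g (below_cons _ _ (hgB _ h))
    · exact notMem_below_of_age (by rw [hage]; have := hglen (a + 1); omega)
    · exact (below_cons_disjoint hij _).mono_right (hgB _)
  · refine hc.notMem_linkColors (g := i :: (List.replicate (a + 1) l ++ w)) (m := i) (n := l)
      hil (x := fanVtx l w (a + 1)) (y := fanVtx l w a) (y' := fanVtx l w (a + 2))
      (corner_cons_self _ _) ?_ (hgco _) (hb _) (fanVtx_adj_succ l w (a + 1)).symm haa.symm
      ?_ ?_ ?_ ?_ ?_
    · rw [corner_cons_of_ne hil.symm, hco]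
    · intro h
      have := congrArg age h
      rw [hage, hage] at this
      omega
    · exact fun h => Set.disjoint_left.1 (hiB (a + 1)) h (hfanB (a + 2))
    · refine fun h => Set.disjoint_left.1 (hjB a) h ?_
      exact below_append [l] _ (hfanB (a + 2))
    · exact fun h => Set.disjoint_left.1 (hjB a) h (hfanB (a + 1))
    · exact ((hjB a).mono_right (below_cons _ _)).symm
  · refine hc.notMem_linkColors (g := i :: (List.replicate (a + 2) l ++ w)) (m := l) (n := i)
      hil.symm (x := fanVtx l w (a + 1)) (y := fanVtx l w (a + 2)) (y' := fanVtx l w a)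
      ?_ (corner_cons_self _ _) (hgco _) (hb _) (fanVtx_adj_succ l w a) haa
      ?_ ?_ ?_ ?_ ?_
    · rw [corner_cons_of_ne hil.symm, hco]
    · intro h
      have := congrArg age h
      rw [hage, hage] at this
      omega
    · exact notMem_below_of_age (by rw [hage]; simp)
    · exact notMem_below_of_age (by rw [hage]; have := hglen (a + 2); omega)
    · exact notMem_below_of_age (by rw [hage]; have := hglen (a + 2); omega)
    · exact (below_cons_disjoint hij _).mono_right (hgB _)

lemma NoLongSquare.exists_clean_pair (hc : NoLongSquare k c) (w : List (Fin 3)) {i j l : Fin 3}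
    (hil : i ≠ l) (hjl : j ≠ l) :
    ∃ a, Clean c (List.replicate a l ++ w) i ∧ Clean c (List.replicate a l ++ w) j := by
  obtain ⟨a, ha⟩ := hc.exists_clean w hil
  obtain ⟨b, hb⟩ := hc.exists_clean (List.replicate a l ++ w) hjl
  refine ⟨b + a, ?_⟩
  rw [← List.replicate_append_replicate, List.append_assoc]
  exact ⟨ha.append (notMem_replicate hil b), hb⟩

lemma card_compl_triple {x y z : Fin 10} (hxy : x ≠ y) (hxz : x ≠ z) (hyz : y ≠ z) :
    (({x, y, z} : Finset (Fin 10))ᶜ).card = 7 := by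
  rw [Finset.card_compl, Finset.card_eq_three.2 ⟨x, y, z, hxy, hxz, hyz, rfl⟩, Fintype.card_fin]

/-- With ten colors, every fan has four colors at least: on the tail of a fan, three consecutive
colors are distinct. -/
lemma NoLongSquare.four_le_fanColors (hc : NoLongSquare k c) (w : List (Fin 3)) (l : Fin 3) :
    4 ≤ (fanColors c w l).card := by
  obtain ⟨i, j, hij, hil, hjl⟩ : ∃ i j : Fin 3, i ≠ j ∧ i ≠ l ∧ j ≠ l :=
    ⟨third l l, third l (third l l), (third_ne_right _ _).symm, third_ne_left _ _,
      third_ne_left _ _⟩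
  obtain ⟨w', hw', hi, hj⟩ : ∃ w', fanColors c w' l ⊆ fanColors c w l ∧ Clean c w' i ∧
      Clean c w' j := by
    obtain ⟨a, hi, hj⟩ := hc.exists_clean_pair w hil hjl
    exact ⟨_, fanColors_replicate_subset w l a, hi, hj⟩
  obtain ⟨V, hVsub, hVlink, hor, hrep⟩ := hc.fan_dichotomy hij hil hjl hi hj
  have hS : ∀ a b, a = b + 1 ∨ b = a + 1 →
      c (fanVtx l w' a) ∉ ({c (corner w' i), c (corner w' j), c (fanVtx l w' b)} :
        Finset (Fin 10)) := by
    intro a b hab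
    simp only [Finset.mem_insert, Finset.mem_singleton, not_or]
    refine ⟨hc.fan_ne_corner hil w' a, hc.fan_ne_corner hjl w' a, ?_⟩
    rcases hab with rfl | rfl
    · exact hc.fan_ne_succ l w' b
    · exact (hc.fan_ne_succ l w' a).symm
  have hper := eventually_eq_or_ne (f := fun a => c (fanVtx l w' a)) (V := V)
    (S := fun a => {c (corner w' i), c (corner w' j), c (fanVtx l w' a)}) ?_
    (fun a => hS _ _ (Or.inl rfl)) (fun a => hS _ _ (Or.inr rfl)) hor
    (fun a h => (hrep a h).1) (fun a h => (hrep a h).2)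
  · rcases hper with ⟨a₀, h⟩ | ⟨a₀, h⟩
    · refine absurd (fun a => ?_) (hc.fan_not_periodic l (List.replicate a₀ l ++ w') two_pos)
      rw [fanVtx_add, fanVtx_add]
      exact (h (a₀ + a) (by omega)).symm
    · by_contra hlt
      refine hc.fan_not_periodic l (List.replicate a₀ l ++ w') (P := 3) (by norm_num) fun a => ?_
      by_contra hne
      rw [fanVtx_add, fanVtx_add] at hne
      set f : ℕ → Fin 10 := fun a => c (fanVtx l w' a) with hf
      have h₁ : ∀ a, f (a + 1) ≠ f a := hc.fan_ne_succ l w'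
      have hsub : ({f (a₀ + a), f (a₀ + a + 1), f (a₀ + a + 2), f (a₀ + a + 3)} :
          Finset (Fin 10)) ⊆ fanColors c w l := by
        refine Finset.Subset.trans ?_ hw'
        intro x hx
        simp only [Finset.mem_insert, Finset.mem_singleton] at hx
        rcases hx with rfl | rfl | rfl | rfl <;> exact fanVtx_mem_fanColors _ _ _
      have hcard := Finset.card_le_card hsub
      rw [Finset.card_insert_of_notMem, Finset.card_insert_of_notMem, Finset.card_pair] at hcard
      · exact hlt hcard
      · exact (h₁ _).symm
      · simp only [Finset.mem_insert, Finset.mem_singleton, not_or]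
        exact ⟨(h₁ _).symm, h (a₀ + a + 1) (by omega)⟩
      · simp only [Finset.mem_insert, Finset.mem_singleton, not_or]
        exact ⟨(h₁ _).symm, h (a₀ + a) (by omega), fun h => hne h.symm⟩
  · intro a x hx y hy hxV hyV
    by_contra hxy
    obtain ⟨g, m, hgm⟩ := hVlink a
    have h₁ := hc.six_le_linkColors g m
    rw [← hgm] at h₁
    have h₂ : V a ⊆ (({c (corner w' i), c (corner w' j), c (fanVtx l w' a)}ᶜ : Finset _).erase
        x).erase y := fun z hz =>
      Finset.mem_erase.2 ⟨fun h => hyV (h ▸ hz), Finset.mem_erase.2 ⟨fun h => hxV (h ▸ hz),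
        hVsub a hz⟩⟩
    have h₃ := Finset.card_le_card h₂
    rw [Finset.card_erase_of_mem (Finset.mem_erase.2 ⟨Ne.symm hxy, Finset.mem_compl.2 hy⟩),
      Finset.card_erase_of_mem (Finset.mem_compl.2 hx), card_compl_triple (hc.corner_ne w' hij)
        (hc.fan_ne_corner hil w' a).symm (hc.fan_ne_corner hjl w' a).symm] at h₃
    omega

/-- There is no coloring of the infinite network with ten colors without long squares: the
vertices of a fan would have palettes with all seven colors that are possible for them, which
contradicts that one of two consecutive vertices misses the color of the other. -/
theorem not_noLongSquare (k : ℕ) (c : Vtx → Fin 10) : ¬ NoLongSquare k c := by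
  intro hc
  have h02 : (0 : Fin 3) ≠ 2 := by decide
  have h12 : (1 : Fin 3) ≠ 2 := by decide
  have h01 : (0 : Fin 3) ≠ 1 := by decide
  obtain ⟨a, hi, hj⟩ := hc.exists_clean_pair [] h02 h12
  generalize List.replicate a (2 : Fin 3) ++ [] = w at hi hj
  obtain ⟨V, hVsub, hVlink, hor, -⟩ := hc.fan_dichotomy h01 h02 h12 hi hj
  have hV : ∀ a, V a = {c (corner w 0), c (corner w 1), c (fanVtx 2 w a)}ᶜ := by
    intro a
    obtain ⟨g, m, hgm⟩ := hVlink a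
    refine Finset.eq_of_subset_of_card_le (hVsub a) ?_
    rw [card_compl_triple (hc.corner_ne w h01) (hc.fan_ne_corner h02 w a).symm
      (hc.fan_ne_corner h12 w a).symm, hgm]
    exact hc.add_three_le_linkColors (by norm_num) hc.four_le_fanColors g m
  have hne := hc.fan_ne_succ 2 w 0
  rcases hor 0 with h | h <;> rw [hV] at h <;> refine h ?_ <;>
    simp only [Finset.mem_compl, Finset.mem_insert, Finset.mem_singleton, not_or]
  · exact ⟨hc.fan_ne_corner h02 w _, hc.fan_ne_corner h12 w _, hne⟩
  · exact ⟨hc.fan_ne_corner h02 w _, hc.fan_ne_corner h12 w _, hne.symm⟩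

/-! ### A straight-line drawing of the network -/

/-- The barycentric coordinates of a point of the plane with respect to the corners of a face, in
the drawing in which the outer corners are `(1, 0)`, `(0, 1)`, `(0, 0)` and each vertex is stacked
into the centroid of its face. -/
noncomputable def bary : List (Fin 3) → EuclideanSpace ℝ (Fin 2) → Fin 3 → ℝ
  | [], x => ![x 0, x 1, 1 - x 0 - x 1]
  | i :: w, x => fun j => if j = i then 3 * bary w x i else bary w x j - bary w x i

/-- The positions of the corners of a face. -/
noncomputable def cornerPos : List (Fin 3) → Fin 3 → EuclideanSpace ℝ (Fin 2)
  | [] => ![!₂[1, 0], !₂[0, 1], !₂[0, 0]]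
  | i :: w => fun j =>
    if j = i then (1 / 3 : ℝ) • cornerPos w 0 + (1 / 3 : ℝ) • cornerPos w 1 +
      (1 / 3 : ℝ) • cornerPos w 2
    else cornerPos w j

/-- The positions of the vertices. -/
noncomputable def vtxPos : Vtx → EuclideanSpace ℝ (Fin 2)
  | Sum.inl j => cornerPos [] j
  | Sum.inr w => (1 / 3 : ℝ) • cornerPos w 0 + (1 / 3 : ℝ) • cornerPos w 1 +
      (1 / 3 : ℝ) • cornerPos w 2

lemma vtxPos_corner (w : List (Fin 3)) (j : Fin 3) : vtxPos (corner w j) = cornerPos w j := by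
  induction w with
  | nil => rfl
  | cons i w ih =>
    by_cases h : j = i
    · subst h; simp [cornerPos, vtxPos]
    · simp [corner_cons_of_ne h, ih, cornerPos, h]

lemma bary_combination (w : List (Fin 3)) (x y z : EuclideanSpace ℝ (Fin 2)) {a b d : ℝ}
    (h : a + b + d = 1) (j : Fin 3) :
    bary w (a • x + b • y + d • z) j = a * bary w x j + b * bary w y j + d * bary w z j := by
  induction w generalizing j with
  | nil =>
    fin_cases j
    · simp [bary]
    · simp [bary]
    · simp [bary]
      linear_combination (-1 : ℝ) * h
  | cons i w ih =>
    simp only [bary, ih]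
    split_ifs <;> ring

lemma bary_cornerPos (w : List (Fin 3)) (i j : Fin 3) :
    bary w (cornerPos w i) j = if j = i then 1 else 0 := by
  induction w generalizing i j with
  | nil => fin_cases i <;> fin_cases j <;> simp [bary, cornerPos]
  | cons l w ih =>
    simp only [bary, cornerPos]
    by_cases hi : i = l
    · have h3 : ∀ m : Fin 3, bary w ((1 / 3 : ℝ) • cornerPos w 0 + (1 / 3 : ℝ) • cornerPos w 1 +
          (1 / 3 : ℝ) • cornerPos w 2) m = 1 / 3 := by
        intro m
        rw [bary_combination w _ _ _ (by norm_num), ih, ih, ih]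
        fin_cases m <;> simp
      simp only [hi, if_true, h3]
      split_ifs <;> norm_num
    · simp only [hi, if_false, ih, Ne.symm hi]
      by_cases hj : j = l
      · subst hj; simp [Ne.symm hi]
      · simp [hj]

lemma bary_vtxPos_inr (w : List (Fin 3)) (j : Fin 3) :
    bary w (vtxPos (Sum.inr w)) j = 1 / 3 := by
  have := bary_cornerPos (j :: w) j j
  rw [← vtxPos_corner, corner_cons_self] at this
  simp only [bary, if_true] at this
  linarith

/-- The point `x` lies in the interior of the face `w`. -/
def Inside (w : List (Fin 3)) (x : EuclideanSpace ℝ (Fin 2)) : Prop := ∀ j, 0 < bary w x j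

lemma Inside.of_cons {i : Fin 3} {w : List (Fin 3)} {x : EuclideanSpace ℝ (Fin 2)}
    (h : Inside (i :: w) x) : Inside w x ∧ ∀ j ≠ i, bary w x i < bary w x j := by
  have hi := h i
  simp only [bary, if_true] at hi
  have hj : ∀ j ≠ i, bary w x i < bary w x j := fun j hj => by
    have := h j
    simp only [bary, hj, if_false] at this
    linarith
  refine ⟨fun j => ?_, hj⟩
  by_cases hji : j = i
  · subst hji; linarith
  · linarith [hj j hji]

lemma Inside.of_append {u w : List (Fin 3)} {x : EuclideanSpace ℝ (Fin 2)}
    (h : Inside (u ++ w) x) : Inside w x := by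
  induction u with
  | nil => exact h
  | cons i u ih => exact ih (Inside.of_cons h).1

/-- The point `x` lies in the interior of the face `w`, but not in that of any of its three
subfaces. -/
def OnSkeleton (w : List (Fin 3)) (x : EuclideanSpace ℝ (Fin 2)) : Prop :=
  Inside w x ∧ ∀ i, ¬ Inside (i :: w) x

lemma OnSkeleton.suffix {w w' : List (Fin 3)} {x : EuclideanSpace ℝ (Fin 2)}
    (h : OnSkeleton w x) (h' : Inside w' x) : w' <:+ w := by
  induction w' with
  | nil => exact List.nil_suffix
  | cons i w' ih =>
    obtain ⟨u, rfl⟩ := ih h'.of_cons.1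
    rcases List.eq_nil_or_concat u with rfl | ⟨u, j, rfl⟩
    · exact absurd h' (h.2 i)
    · have hj : Inside (j :: w') x := by
        have := h.1
        rw [List.concat_eq_append, List.append_assoc] at this
        exact this.of_append
      obtain rfl : i = j := by
        by_contra hij
        exact lt_asymm (h'.of_cons.2 j (Ne.symm hij)) (hj.of_cons.2 i hij)
      exact ⟨u, by simp⟩

lemma OnSkeleton.unique {w w' : List (Fin 3)} {x : EuclideanSpace ℝ (Fin 2)}
    (h : OnSkeleton w x) (h' : OnSkeleton w' x) : w = w' :=
  List.IsSuffix.eq_of_length_le (h'.suffix h.1) (h.suffix h'.1).length_le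

/-- The point `x` lies on the open segment from the centroid of the face `w` to its `j`-th
corner. -/
def OnEdge (w : List (Fin 3)) (j : Fin 3) (x : EuclideanSpace ℝ (Fin 2)) : Prop :=
  Inside w x ∧ (∀ i ≠ j, bary w x i < bary w x j) ∧
    ∀ i ≠ j, ∀ i' ≠ j, bary w x i = bary w x i'

lemma OnEdge.onSkeleton {w : List (Fin 3)} {j : Fin 3} {x : EuclideanSpace ℝ (Fin 2)}
    (h : OnEdge w j x) : OnSkeleton w x := by
  refine ⟨h.1, fun i hi => ?_⟩
  by_cases hij : i = j
  · subst hij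
    have h₁ := h.2.1 _ (third_ne_left i i)
    have h₂ := hi.of_cons.2 _ (third_ne_left i i)
    exact lt_asymm h₁ h₂
  · have h₁ := h.2.2 i hij _ (third_ne_right i j)
    have h₂ := hi.of_cons.2 _ (third_ne_left i j)
    exact h₂.ne h₁

lemma onSkeleton_vtxPos_inr (w : List (Fin 3)) : OnSkeleton w (vtxPos (Sum.inr w)) := by
  refine ⟨fun j => by rw [bary_vtxPos_inr]; norm_num, fun i hi => ?_⟩
  have := hi.of_cons.2 _ (third_ne_left i i)
  rw [bary_vtxPos_inr, bary_vtxPos_inr] at this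
  exact lt_irrefl _ this

lemma not_inside_vtxPos_inl (w : List (Fin 3)) (j : Fin 3) : ¬ Inside w (vtxPos (Sum.inl j)) := by
  intro h
  rw [← List.append_nil w] at h
  have h₁ := h.of_append (third j j)
  have h₂ : bary [] (vtxPos (Sum.inl j)) (third j j) = 0 := by
    have := bary_cornerPos [] j (third j j)
    rwa [if_neg (third_ne_left j j)] at this
  exact h₁.ne' h₂

lemma vtxPos_injective : Function.Injective vtxPos := by
  rintro (i | w) (j | w') h
  · by_contra hne
    have h₁ := bary_cornerPos [] i i
    have h₂ := bary_cornerPos [] j i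
    rw [if_pos rfl] at h₁
    rw [if_neg (fun h => hne (by rw [h]))] at h₂
    have h₃ : cornerPos [] i = cornerPos [] j := h
    rw [h₃, h₂] at h₁
    norm_num at h₁
  · exact absurd (h ▸ (onSkeleton_vtxPos_inr w').1) (not_inside_vtxPos_inl _ i)
  · exact absurd (h ▸ (onSkeleton_vtxPos_inr w).1) (not_inside_vtxPos_inl _ j)
  · rw [(onSkeleton_vtxPos_inr w).unique (h ▸ onSkeleton_vtxPos_inr w')]

lemma OnEdge.ne_vtxPos {w : List (Fin 3)} {j : Fin 3} {x : EuclideanSpace ℝ (Fin 2)}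
    (h : OnEdge w j x) (v : Vtx) : x ≠ vtxPos v := by
  rintro rfl
  rcases v with i | w'
  · exact not_inside_vtxPos_inl _ i h.1
  · obtain rfl := h.onSkeleton.unique (onSkeleton_vtxPos_inr w')
    have := h.2.1 _ (third_ne_left j j)
    rw [bary_vtxPos_inr, bary_vtxPos_inr] at this
    exact lt_irrefl _ this

lemma OnEdge.unique {w w' : List (Fin 3)} {j j' : Fin 3} {x : EuclideanSpace ℝ (Fin 2)}
    (h : OnEdge w j x) (h' : OnEdge w' j' x) : w = w' ∧ j = j' := by
  obtain rfl := h.onSkeleton.unique h'.onSkeleton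
  refine ⟨rfl, ?_⟩
  by_contra hne
  exact lt_asymm (h.2.1 j' (Ne.symm hne)) (h'.2.1 j hne)

lemma onEdge_or_eq_of_mem_segment {w : List (Fin 3)} {j : Fin 3} {x : EuclideanSpace ℝ (Fin 2)}
    (hx : x ∈ segment ℝ (vtxPos (Sum.inr w)) (vtxPos (corner w j))) :
    x = vtxPos (Sum.inr w) ∨ x = vtxPos (corner w j) ∨ OnEdge w j x := by
  obtain ⟨a, b, ha, hb, hab, rfl⟩ := hx
  rcases hb.eq_or_lt with rfl | hb
  · left
    rw [add_zero] at hab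
    simp [hab]
  rcases ha.eq_or_lt with rfl | ha
  · right; left
    rw [zero_add] at hab
    simp [hab]
  right; right
  have key : ∀ i, bary w (a • vtxPos (Sum.inr w) + b • vtxPos (corner w j)) i =
      a / 3 + if i = j then b else 0 := by
    intro i
    have := bary_combination w (vtxPos (Sum.inr w)) (vtxPos (corner w j)) 0 (d := 0)
      (by rw [add_zero, hab]) i
    rw [zero_smul, add_zero] at this
    rw [this, bary_vtxPos_inr, vtxPos_corner, bary_cornerPos]
    split_ifs <;> ring
  refine ⟨fun i => ?_, fun i hi => ?_, fun i hi i' hi' => ?_⟩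
  · rw [key]
    split_ifs <;> positivity
  · rw [key, key, if_neg hi, if_pos rfl]
    linarith
  · rw [key, key, if_neg hi, if_neg hi']

/-- The segment between two vertices, as a function of the unordered pair. -/
noncomputable def edgeSegment (e : Sym2 Vtx) : Set (EuclideanSpace ℝ (Fin 2)) :=
  Sym2.lift ⟨fun u v => segment ℝ (vtxPos u) (vtxPos v), fun _ _ => segment_symm _ _ _⟩ e

lemma exists_of_mem_edgeSegment {e : Sym2 Vtx} (he : e ∈ apollonian.edgeSet)
    {x : EuclideanSpace ℝ (Fin 2)} (hx : x ∈ edgeSegment e) :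
    (∃ v ∈ e, x = vtxPos v) ∨ ∃ w j, e = s(Sum.inr w, corner w j) ∧ OnEdge w j x := by
  obtain ⟨w, j, rfl⟩ : ∃ w j, e = s(Sum.inr w, corner w j) := by
    induction e with
    | h u v =>
      rcases he with ⟨w, j, rfl, rfl⟩ | ⟨w, j, rfl, rfl⟩
      · exact ⟨w, j, rfl⟩
      · exact ⟨w, j, Sym2.eq_swap⟩
  rcases onEdge_or_eq_of_mem_segment hx with h | h | h
  · exact Or.inl ⟨_, Sym2.mem_mk_left _ _, h⟩
  · exact Or.inl ⟨_, Sym2.mem_mk_right _ _, h⟩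
  · exact Or.inr ⟨w, j, rfl, h⟩

lemma mem_of_vtxPos_mem {e : Sym2 Vtx} (he : e ∈ apollonian.edgeSet) {v : Vtx}
    (hv : vtxPos v ∈ edgeSegment e) : v ∈ e := by
  rcases exists_of_mem_edgeSegment he hv with ⟨u, hu, h⟩ | ⟨w, j, -, h⟩
  · exact vtxPos_injective h ▸ hu
  · exact absurd rfl (h.ne_vtxPos v)

lemma isPlanar_apollonian : IsPlanar apollonian := by
  refine ⟨⟨vtxPos, vtxPos_injective, edgeSegment, fun u v huv => ?_,
    fun e he w => mem_of_vtxPos_mem he, fun e he f hf hef x hx => ?_⟩⟩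
  · have hne : vtxPos u ≠ vtxPos v := vtxPos_injective.ne huv.ne
    refine ⟨⟨⟨fun t => AffineMap.lineMap (vtxPos u) (vtxPos v) (t : ℝ), ?_⟩, by simp, by simp⟩,
      fun s t hst => ?_, ?_⟩
    · exact AffineMap.lineMap_continuous.comp continuous_subtype_val
    · exact Subtype.ext (AffineMap.lineMap_injective ℝ hne hst)
    · show Set.range (fun t : unitInterval => AffineMap.lineMap (vtxPos u) (vtxPos v) (t : ℝ)) =
        segment ℝ (vtxPos u) (vtxPos v)
      rw [segment_eq_image_lineMap, Set.image_eq_range]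
  · rcases exists_of_mem_edgeSegment he hx.1 with ⟨v, hv, rfl⟩ | ⟨w, j, rfl, h⟩
    · exact ⟨v, hv, mem_of_vtxPos_mem hf hx.2, rfl⟩
    · rcases exists_of_mem_edgeSegment hf hx.2 with ⟨v, hv, rfl⟩ | ⟨w', j', rfl, h'⟩
      · exact absurd rfl (h.ne_vtxPos v)
      · obtain ⟨rfl, rfl⟩ := h.unique h'
        exact absurd rfl hef

lemma IsPlanar.induce {V : Type*} {G : SimpleGraph V} (h : IsPlanar G) (s : Set V) :
    IsPlanar (G.induce s) := by
  obtain ⟨D⟩ := h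
  have hmem : ∀ {e : Sym2 s}, e ∈ (G.induce s).edgeSet →
      e.map Subtype.val ∈ G.edgeSet := by
    intro e he
    induction e with
    | h u v => exact he
  refine ⟨⟨fun v => D.pos v, D.pos_injective.comp Subtype.val_injective,
    fun e => D.arc (e.map Subtype.val), fun u v huv => D.arc_simple u v huv,
    fun e he w hw => ?_, fun e he f hf hef x hx => ?_⟩⟩
  · obtain ⟨v, hv, hvw⟩ := Sym2.mem_map.1 (D.mem_of_pos_mem _ (hmem he) w hw)
    rwa [← Subtype.ext hvw]
  · obtain ⟨w, hwe, hwf, rfl⟩ := D.arc_inter _ (hmem he) _ (hmem hf)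
      (fun h => hef (Sym2.map.injective Subtype.val_injective h)) x hx
    obtain ⟨v, hv, rfl⟩ := Sym2.mem_map.1 hwe
    obtain ⟨v', hv', hvv⟩ := Sym2.mem_map.1 hwf
    exact ⟨v, hv, Subtype.ext hvv ▸ hv', rfl⟩

/-! ### Finite truncations and their treewidth -/

/-- The vertices of the network that appear in the first `n` rounds of stacking: the outer corners
and the vertices stacked into faces with a word of length less than `n`. -/
def truncation (n : ℕ) : Set Vtx := {v | age v ≤ n}

lemma finite_truncation (n : ℕ) : (truncation n).Finite := by
  refine ((Set.finite_range (Sum.inl : Fin 3 → Vtx)).union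
    ((List.finite_length_lt (Fin 3) n).image Sum.inr)).subset ?_
  rintro (i | w) h
  · exact Or.inl ⟨i, rfl⟩
  · exact Or.inr ⟨w, h, rfl⟩

lemma corner_mem_truncation {w : List (Fin 3)} {n : ℕ} (h : w.length < n) (i : Fin 3) :
    corner w i ∈ truncation n :=
  (age_corner_le w i).trans h.le

/-- The words of length less than `n`, which index the faces to be stacked. -/
abbrev Face (n : ℕ) : Type := {w : List (Fin 3) // w.length < n}

instance (n : ℕ) : Finite (Face n) := (List.finite_length_lt (Fin 3) n).to_subtype

/-- The tree of faces: a face is joined to its three subfaces. -/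
def faceTree (n : ℕ) : SimpleGraph (Face n) where
  Adj a b := (∃ i, a.1 = i :: b.1) ∨ ∃ i, b.1 = i :: a.1
  symm := ⟨fun _ _ h => h.symm⟩
  loopless := ⟨fun a h => by
    rcases h with ⟨i, h⟩ | ⟨i, h⟩ <;> simpa using congrArg List.length h⟩

/-- A set of faces with a least element `r`, such that with each other face it contains the face
of which that one is a subface, induces a connected subgraph of the tree of faces. -/
lemma connected_induce_faceTree {n : ℕ} (S : Set (Face n)) (r : Face n) (hr : r ∈ S)
    (h : ∀ a ∈ S, a = r ∨ ∃ b ∈ S, ∃ i, a.1 = i :: b.1) :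
    ((faceTree n).induce S).Connected := by
  have key : ∀ m (a : Face n) (ha : a ∈ S), a.1.length = m →
      ((faceTree n).induce S).Reachable ⟨a, ha⟩ ⟨r, hr⟩ := by
    intro m
    induction m with
    | zero =>
      intro a ha hm
      rcases h a ha with rfl | ⟨b, hb, i, hab⟩
      · exact SimpleGraph.Reachable.refl _
      · rw [hab] at hm; simp at hm
    | succ m ih =>
      intro a ha hm
      rcases h a ha with rfl | ⟨b, hb, i, hab⟩
      · exact SimpleGraph.Reachable.refl _
      · rw [hab, List.length_cons] at hm
        refine SimpleGraph.Reachable.trans (SimpleGraph.Adj.reachable ?_) (ih b hb (by omega))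
        exact Or.inl ⟨i, hab⟩
  have : Nonempty S := ⟨⟨r, hr⟩⟩
  exact ⟨fun a b => (key _ a.1 a.2 rfl).trans (key _ b.1 b.2 rfl).symm⟩

lemma isTree_faceTree {n : ℕ} (hn : 0 < n) : (faceTree n).IsTree := by
  let root : Face n := ⟨[], hn⟩
  rw [SimpleGraph.isTree_iff_connected_and_card]
  constructor
  · have := connected_induce_faceTree (Set.univ : Set (Face n)) root (Set.mem_univ _)
      (fun a _ => by
        obtain ⟨w, hw⟩ := a
        cases w with
        | nil => exact Or.inl rfl
        | cons i w => exact Or.inr ⟨⟨w, by simp at hw; omega⟩, Set.mem_univ _, i, rfl⟩)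
    exact (SimpleGraph.induceUnivIso (faceTree n)).connected_iff.1 this
  · -- Each face other than the root contributes the edge to its parent.
    have hlt : ∀ a : Face n, a.1.tail.length < n := fun a =>
      (by simp : a.1.tail.length ≤ a.1.length).trans_lt a.2
    let f : {a : Face n // a ≠ root} → (faceTree n).edgeSet := fun a =>
      ⟨s(a.1, ⟨a.1.1.tail, hlt a.1⟩), by
        obtain ⟨⟨w, hw⟩, ha⟩ := a
        cases w with
        | nil => exact absurd rfl ha
        | cons i w => exact Or.inl ⟨i, rfl⟩⟩
    have hf : Function.Bijective f := by
      constructor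
      · intro a b hab
        have h := congrArg Subtype.val hab
        simp only [f, Sym2.eq_iff] at h
        rcases h with ⟨h, -⟩ | ⟨h₁, h₂⟩
        · exact Subtype.ext h
        · exfalso
          have ha : a.1.1 ≠ [] := fun h => a.2 (Subtype.ext h)
          have h₃ := congrArg (fun x => x.1.length) h₁
          have h₄ := congrArg (fun x => x.1.length) h₂
          simp only [List.length_tail] at h₃ h₄
          have := List.length_pos_iff.2 ha
          omega
      · rintro ⟨e, he⟩
        induction e with
        | h a b =>
          have key : ∀ (a b : Face n) (i : Fin 3), a.1 = i :: b.1 →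
              ∃ x, (f x).1 = s(a, b) := by
            intro a b i hab
            refine ⟨⟨a, fun h => ?_⟩, ?_⟩
            · rw [h] at hab
              simp [root] at hab
            · have : (⟨a.1.tail, hlt a⟩ : Face n) = b := Subtype.ext (by simp [hab])
              simp only [f, this]
          rcases he with ⟨i, h⟩ | ⟨i, h⟩
          · obtain ⟨x, hx⟩ := key a b i h
            exact ⟨x, Subtype.ext hx⟩
          · obtain ⟨x, hx⟩ := key b a i h
            exact ⟨x, Subtype.ext (hx.trans Sym2.eq_swap)⟩
    rw [← Nat.card_congr (Equiv.ofBijective f hf)]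
    have h₁ := Set.ncard_add_ncard_compl ({root} : Set (Face n))
    rw [Set.ncard_singleton, add_comm] at h₁
    exact h₁

lemma finite_bag (w : List (Fin 3)) (n : ℕ) :
    {v : truncation n | v.1 = Sum.inr w ∨ ∃ i, v.1 = corner w i}.Finite := by
  have := (finite_truncation n).to_subtype
  exact Set.toFinite _

lemma treewidthAtMost_three {n : ℕ} (hn : 0 < n) :
    TreewidthAtMost 3 (apollonian.induce (truncation n)) := by
  have hmem : ∀ (w : Face n) (v : truncation n), v ∈ (finite_bag w.1 n).toFinset ↔
      v.1 = Sum.inr w.1 ∨ ∃ i, v.1 = corner w.1 i := fun w v => by simp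
  refine ⟨Face n, ⟨inferInstance, faceTree n, isTree_faceTree hn,
    fun w => (finite_bag w.1 n).toFinset, ?_, ?_, ?_⟩, ?_⟩
  · rintro ⟨i | w, hv⟩
    · exact ⟨⟨[], hn⟩, (hmem _ _).2 (Or.inr ⟨i, rfl⟩)⟩
    · exact ⟨⟨w, hv⟩, (hmem _ _).2 (Or.inl rfl)⟩
  · rintro ⟨u, hu⟩ ⟨v, hv⟩ (⟨w, i, rfl, rfl⟩ | ⟨w, i, rfl, rfl⟩)
    · exact ⟨⟨w, hu⟩, (hmem _ _).2 (Or.inl rfl), (hmem _ _).2 (Or.inr ⟨i, rfl⟩)⟩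
    · exact ⟨⟨w, hv⟩, (hmem _ _).2 (Or.inr ⟨i, rfl⟩), (hmem _ _).2 (Or.inl rfl)⟩
  · intro v
    have step : ∀ a : Face n, v ∈ (finite_bag a.1 n).toFinset → v.1 ≠ Sum.inr a.1 →
        (∃ i, v.1 = Sum.inl i) ∧ a.1 = [] ∨
          ∃ b : Face n, v ∈ (finite_bag b.1 n).toFinset ∧ ∃ i, a.1 = i :: b.1 := by
      rintro ⟨w, hw⟩ ha hne
      rcases (hmem _ _).1 ha with h | ⟨j, h⟩
      · exact absurd h hne
      · cases w with
        | nil => exact Or.inl ⟨⟨j, h⟩, rfl⟩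
        | cons i w =>
          refine Or.inr ⟨⟨w, by simp at hw; omega⟩, (hmem _ _).2 ?_, i, rfl⟩
          by_cases hji : j = i
          · subst hji; exact Or.inl (by rw [h, corner_cons_self])
          · exact Or.inr ⟨j, by rw [h, corner_cons_of_ne hji]⟩
    rcases v with ⟨i | w, hv⟩
    · refine connected_induce_faceTree _ ⟨[], hn⟩ ((hmem _ _).2 (Or.inr ⟨i, rfl⟩)) fun a ha => ?_
      rcases step a ha (by simp) with ⟨-, h⟩ | h
      · exact Or.inl (Subtype.ext h)
      · exact Or.inr h
    · refine connected_induce_faceTree _ ⟨w, hv⟩ ((hmem _ _).2 (Or.inl rfl)) fun a ha => ?_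
      by_cases hne : (Sum.inr w : Vtx) = Sum.inr a.1
      · exact Or.inl (Subtype.ext (Sum.inr_injective hne).symm)
      · rcases step a ha hne with ⟨⟨i, h⟩, -⟩ | h
        · cases h
        · exact Or.inr h
  · intro w
    let f : Option (Fin 3) → truncation n := fun o =>
      o.elim ⟨Sum.inr w.1, w.2⟩ fun i => ⟨corner w.1 i, corner_mem_truncation w.2 i⟩
    classical
    have hsub : (finite_bag w.1 n).toFinset ⊆ Finset.univ.image f := by
      intro v hv
      rw [Finset.mem_image]
      rcases (hmem _ _).1 hv with h | ⟨i, h⟩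
      · exact ⟨none, Finset.mem_univ _, Subtype.ext h.symm⟩
      · exact ⟨some i, Finset.mem_univ _, Subtype.ext h.symm⟩
    exact (Finset.card_le_card hsub).trans Finset.card_image_le

/-! ### Compactness and the conclusion -/

lemma eventually_mem_truncation (v : Vtx) :
    ∀ᶠ n in (Filter.hyperfilter ℕ : Filter ℕ), v ∈ truncation (n + 1) := by
  refine Filter.Eventually.filter_mono Nat.hyperfilter_le_atTop ?_
  filter_upwards [Filter.eventually_ge_atTop (age v)] with n hn
  exact hn.trans n.le_succ

/-- If all truncations had colorings with ten colors that avoid long squares, then so would the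
infinite network: take the limit of the colorings along an ultrafilter. -/
lemma exists_truncation_not_avoidsSquares (k : ℕ) :
    ∃ n, 0 < n ∧ ∀ c : truncation n → Fin 10,
      ¬ AvoidsSquares (apollonian.induce (truncation n)) k c := by
  by_contra hcon
  push Not at hcon
  choose f hf using fun n => hcon (n + 1) n.succ_pos
  classical
  let g : ℕ → Vtx → Fin 10 := fun n v => if h : v ∈ truncation (n + 1) then f n ⟨v, h⟩ else 0
  have hlim : ∀ v, ∃ x, ∀ᶠ n in (Filter.hyperfilter ℕ : Filter ℕ), g n v = x := by
    intro v
    obtain ⟨x, hx⟩ := Ultrafilter.eq_pure_of_finite ((Filter.hyperfilter ℕ).map fun n => g n v)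
    refine ⟨x, ?_⟩
    have : ({x} : Set (Fin 10)) ∈ (Filter.hyperfilter ℕ).map fun n => g n v := by
      rw [hx]; exact Set.mem_singleton x
    exact this
  choose c hc using hlim
  refine not_noLongSquare k c fun A B hchain hnodup hlen hAB => ?_
  have hev : ∀ᶠ n in (Filter.hyperfilter ℕ : Filter ℕ),
      ∀ v ∈ {v | v ∈ A ++ B}, v ∈ truncation (n + 1) ∧ g n v = c v := by
    rw [Filter.eventually_all_finite (List.finite_toSet _)]
    exact fun v _ => (eventually_mem_truncation v).and (hc v)
  obtain ⟨n, hn⟩ := hev.exists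
  lift A to List (truncation (n + 1)) using fun v hv => (hn v (by simp [hv])).1
  lift B to List (truncation (n + 1)) using fun v hv => (hn v (by simp [hv])).1
  rw [← List.map_append] at hchain hnodup
  have hchain' : (A ++ B).IsChain (apollonian.induce (truncation (n + 1))).Adj :=
    (List.isChain_map Subtype.val).1 hchain
  have hne : A ++ B ≠ [] := by
    intro h
    rw [List.append_eq_nil_iff.1 h |>.1] at hlen
    simp at hlen
  have hcol : ∀ v ∈ A ++ B, f n v = c v := by
    intro v hv
    have := (hn v (by rw [Set.mem_ofPred_eq, ← List.map_append]; exact List.mem_map_of_mem hv)).2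
    simpa [g, v.2] using this
  rw [List.length_map] at hlen
  refine hf n _ _ (SimpleGraph.Walk.ofSupport (A ++ B) hne hchain') ?_ A.length hlen.le
    ⟨by omega, A.map (f n), by simp, ?_⟩
  · rw [SimpleGraph.Walk.isPath_def, SimpleGraph.Walk.support_ofSupport]
    exact hnodup.of_map _
  · rw [SimpleGraph.Walk.support_ofSupport, List.map_append]
    congr 1
    have h₁ : A.map (f n) = (A.map Subtype.val).map c := by
      rw [List.map_map]
      exact List.map_congr_left fun v hv => hcol v (by simp [hv])
    have h₂ : B.map (f n) = (B.map Subtype.val).map c := by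
      rw [List.map_map]
      exact List.map_congr_left fun v hv => hcol v (by simp [hv])
    rw [h₁, h₂, hAB]

/-- Renaming the colors by an injection does not create squares. -/
lemma AvoidsSquares.comp_injective {V α β : Type*} {G : SimpleGraph V} {k : ℕ} {c : V → α}
    (h : AvoidsSquares G k c) {φ : α → β} (hφ : Function.Injective φ) :
    AvoidsSquares G k (φ ∘ c) := by
  rintro u v P hP p hp ⟨hpos, w, hw, hs⟩
  rw [← List.map_map] at hs
  obtain ⟨a, b, hab, ha, hb⟩ := List.map_eq_append_iff.1 hs
  obtain rfl : a = b := List.map_injective_iff.2 hφ (ha.trans hb.symm)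
  exact h u v P hP p hp ⟨hpos, a, by rw [← hw, ← ha, List.length_map], hab⟩

lemma eleven_le_thueNumber {V : Type*} {G : SimpleGraph V} {k : ℕ}
    (h : ∀ c : V → Fin 10, ¬ AvoidsSquares G k c) : 11 ≤ thueNumber k G := by
  refine le_iInf₂ fun m ⟨c, hc⟩ => ?_
  by_contra hlt
  have hm : m ≤ 10 := by
    have : (m : ℕ∞) < (11 : ℕ) := not_le.1 hlt
    have := Nat.cast_lt.1 this
    omega
  exact h _ (hc.comp_injective (Fin.castLE_injective hm))

lemma thueNumber_le_classThueNumber {k : ℕ} {C : ∀ V : Type, SimpleGraph V → Prop} {V : Type}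
    [Finite V] {G : SimpleGraph V} (h : C V G) : thueNumber k G ≤ classThueNumber k C :=
  le_iSup_of_le V (le_iSup_of_le ‹_› (le_iSup_of_le G (le_iSup_of_le h le_rfl)))

lemma classThueNumber_mono {k : ℕ} {C D : ∀ V : Type, SimpleGraph V → Prop}
    (h : ∀ V G, C V G → D V G) : classThueNumber k C ≤ classThueNumber k D :=
  iSup_le fun V => iSup_le fun hV => iSup_le fun G => iSup_le fun hG =>
    haveI := hV
    thueNumber_le_classThueNumber (h V G hG)

end ThuePlanar

theorem theorem4 :
    (∀ k : ℕ, 11 ≤ ThuePlanar.classThueNumber k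
      (fun _ G => ThuePlanar.IsPlanar G ∧ ThuePlanar.TreewidthAtMost 3 G)) ∧
    ¬ ∃ k : ℕ, ThuePlanar.classThueNumber k (fun _ G => ThuePlanar.IsPlanar G) = 4 := by
  have main : ∀ k : ℕ, 11 ≤ ThuePlanar.classThueNumber k
      (fun _ G => ThuePlanar.IsPlanar G ∧ ThuePlanar.TreewidthAtMost 3 G) := by
    intro k
    obtain ⟨n, hn, h⟩ := ThuePlanar.exists_truncation_not_avoidsSquares k
    have := (ThuePlanar.finite_truncation n).to_subtype
    exact (ThuePlanar.eleven_le_thueNumber h).trans (ThuePlanar.thueNumber_le_classThueNumber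
      (C := fun _ G => ThuePlanar.IsPlanar G ∧ ThuePlanar.TreewidthAtMost 3 G)
      ⟨ThuePlanar.isPlanar_apollonian.induce _, ThuePlanar.treewidthAtMost_three hn⟩)
  refine ⟨main, fun ⟨k, hk⟩ => ?_⟩
  have h : (11 : ℕ∞) ≤ 4 := ((main k).trans
    (ThuePlanar.classThueNumber_mono fun _ _ h => h.1)).trans hk.le
  exact absurd h (by decide)
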